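/- Let $n\ge 1$ and let $H=-\Delta+V$ be a Schrödinger operator with a real-valued potential $V$ that is self-adjoint in $L_2(\mathbb{R}^n)$; for continuous compactly supported $\phi:\mathbb{R}\to\mathbb{R}$ let $\phi(H)=\int\phi(\lambda)\,dE_\lambda$ be given by the functional calculus and denote its integral kernel by $\phi(H)(x,y)$. Consider families $\{\varphi_j\}_{j\in\mathbb{Z}}\subset C_0^\infty(\mathbb{R})$ of real-valued functions and the conditions (i) $\operatorname{supp}\varphi_j\subset\{x: 2^{j-2}\le|x|\le 2^j\}$; (ii) for every $k\in\mathbb{N}_0$ there is $c_k$ with $|\varphi_j^{(k)}(x)|\le c_k2^{-kj}$ for all $j\in\mathbb{Z}$, $x\in\mathbb{R}$; (iii) there are $0<c_1\le c_2$ with $c_1\le\sum_{j\in\mathbb{Z}}\varphi_j(x)\le c_2$ for all $x\ne0$. A family with (i)–(iii) is called a dyadic system. Assume that for every family $\{\phi_j\}$ satisfying (i) and (ii) the operators $\phi_j(H)$ have kernels, differentiable in $x$, such that for every $N\in\mathbb{N}_0$ there is $c_N>0$ with $$|\phi_j(H)(x,y)|\le c_N\frac{2^{nj/2}}{(1+2^{j/2}|x-y|)^N},\qquad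 |\nabla_x\phi_j(H)(x,y)|\le c_N\frac{2^{(n+1)j/2}}{(1+2^{j/2}|x-y|)^N}$$ for all $j\in\mathbb{Z}$, $x,y\in\mathbb{R}^n$. Let $\{\varphi_j\}$ be a dyadic system, and for a Schwartz function $f\in\mathcal{S}(\mathbb{R}^n)$ and $s>0$ let $$\varphi_{j,s}^*f(x)=\sup_{t\in\mathbb{R}^n}\frac{|\varphi_j(H)f(t)|}{(1+2^{j/2}|x-t|)^s},$$ where $\varphi_j(H)f$ denotes the continuous representative. For $\alpha\in\mathbb{R}$ and $0<q\le\infty$ put, with values in $[0,\infty]$ and the usual modification for $q=\infty$, $$\|f\|_{\dot B_p^{\alpha,q}(H)}=\Big(\sum_{j\in\mathbb{Z}}2^{j\alpha q}\|\varphi_j(H)f\|_p^q\Big)^{1/q}\quad(0<p\le\infty),$$ $$\|f\|_{\dot F_p^{\alpha,q}(H)}=\Big\|\Big(\sum_{j\in\mathbb{Z}}2^{j\alpha q}|\varphi_j(H)f(\cdot)|^q\Big)^{1/q}\Big\|_p\quad(0<p<\infty).$$ The homogeneous Besov space $\dot B_p^{\alpha,q}(H)$ and Triebel–Lizorkin space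 $\dot F_p^{\alpha,q}(H)$ are the completions of (the part of finite quasi-norm of) $\mathcal{S}(\mathbb{R}^n)$ in these quasi-norms. Write $A\approx B$ if $C^{-1}A(f)\le B(f)\le C\,A(f)$ for all $f\in\mathcal{S}(\mathbb{R}^n)$ with a constant $0<C<\infty$ independent of $f$. Then: a) If $0<p\le\infty$, $0<q\le\infty$, $\alpha\in\mathbb{R}$ and $s>n/p$, then $$\|f\|_{\dot B_p^{\alpha,q}(H)}\approx\|\{2^{j\alpha}\varphi_{j,s}^*f\}\|_{\ell^q(L_p)}=\Big(\sum_{j\in\mathbb{Z}}2^{j\alpha q}\|\varphi_{j,s}^*f\|_p^q\Big)^{1/q}$$ (for $p=\infty$ the condition on $s$ is $s>0$). b) If $0<p<\infty$, $0<q\le\infty$, $\alpha\in\mathbb{R}$ and $s>n/\min(p,q)$, then $$\|f\|_{\dot F_p^{\alpha,q}(H)}\approx\|\{2^{j\alpha}\varphi_{j,s}^*f\}\|_{L_p(\ell^q)}=\Big\|\Big(\sum_{j\in\mathbb{Z}}2^{j\alpha q}|\varphi_{j,s}^*f(\cdot)|^q\Big)^{1/q}\Big\|_p .$$ c) Consequently,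 for $\alpha\in\mathbb{R}$, $0<q\le\infty$ and $0<p\le\infty$ (resp. $0<p<\infty$), any two dyadic systems give rise to equivalent quasi-norms $\|\cdot\|_{\dot B_p^{\alpha,q}(H)}$ (resp. $\|\cdot\|_{\dot F_p^{\alpha,q}(H)}$) on $\mathcal{S}(\mathbb{R}^n)$, and to the same completions. -/

import Mathlib

open MeasureTheory Filter Topology
open scoped ENNReal NNReal ContDiff SchwartzMap

noncomputable section

namespace SchrodingerLP

/-- Euclidean space `ℝⁿ`. -/
abbrev Rn (n : ℕ) : Type := EuclideanSpace ℝ (Fin n)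

/-- The complex Hilbert space `L₂(ℝⁿ)` (Lebesgue measure). -/
abbrev L2 (n : ℕ) : Type := Lp ℂ 2 (volume : Measure (Rn n))

/-! ### Schrödinger operators -/

/-- `H` is a self-adjoint (in general unbounded) operator in `L₂(ℝⁿ)` that acts on its domain as
`-Δ + V` in the sense of distributions: for `u ∈ D(H)` the product `V u` is locally integrable and
`∫ (H u) η = ∫ u (-Δ η) + ∫ V u η` for every test function `η`. -/
structure IsSchrodingerOperator {n : ℕ} (V : Rn n → ℝ) (H : L2 n →ₗ.[ℂ] L2 n) : Prop where
  selfAdjoint : IsSelfAdjoint H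
  locallyIntegrable : ∀ u : H.domain,
    LocallyIntegrable (fun x => (V x : ℂ) * ((u : L2 n) : Rn n → ℂ) x) volume
  action : ∀ (u : H.domain) (η : Rn n → ℂ), ContDiff ℝ ∞ η → HasCompactSupport η →
    ∫ x, ((H u : L2 n) : Rn n → ℂ) x * η x =
      (∫ x, ((u : L2 n) : Rn n → ℂ) x * (-(Laplacian.laplacian η x))) +
        ∫ x, (V x : ℂ) * ((u : L2 n) : Rn n → ℂ) x * η x

/-! ### Functional calculus -/

open Classical in
/-- The bounded operator `(H + i)⁻¹`: the operator `R` with `R g ∈ D(H)` and `(H + i) (R g) = g`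
for all `g`. It exists and is unique when `H` is self-adjoint (and is set to `0` in the irrelevant
case that no such `R` exists). -/
def resolventI {n : ℕ} (H : L2 n →ₗ.[ℂ] L2 n) : L2 n →L[ℂ] L2 n :=
  if h : ∃ R : L2 n →L[ℂ] L2 n,
      ∀ g : L2 n, ∃ u : H.domain, (u : L2 n) = R g ∧ H u + Complex.I • (u : L2 n) = g
  then h.choose else 0

open Classical in
/-- For `φ : ℝ → ℝ`, the function `z ↦ φ (z⁻¹ - i)` on the circle `{(λ + i)⁻¹ : λ ∈ ℝ} ∪ {0}`,
with value `0` at `z = 0` (the point that corresponds to `λ = ∞`). -/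
def resolventSymbol (φ : ℝ → ℝ) (z : ℂ) : ℂ :=
  if z = 0 then 0 else ((φ (z⁻¹ - Complex.I).re : ℝ) : ℂ)

/-- The operator `φ(H) = ∫ φ(λ) dE_λ` for a self-adjoint `H` and a continuous, compactly supported
`φ : ℝ → ℝ`. With the bounded normal operator `R = (H + i)⁻¹ = ∫ (λ + i)⁻¹ dE_λ`, whose spectrum
lies on the circle `{(λ + i)⁻¹ : λ ∈ ℝ} ∪ {0}`, one has `φ(H) = g(R)`, where `g` is the continuous
function on that circle with `g ((λ + i)⁻¹) = φ λ` and `g 0 = 0`; here `g(R)` is the continuous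
functional calculus of the normal operator `R`. -/
def spectralOp {n : ℕ} (H : L2 n →ₗ.[ℂ] L2 n) (φ : ℝ → ℝ) : L2 n →L[ℂ] L2 n :=
  cfc (resolventSymbol φ) (resolventI H)

/-- `K` is the (integral) kernel of the operator `T`: `T f (x) = ∫ K(x,y) f(y) dy`. -/
structure IsKernelOf {n : ℕ} (K : Rn n → Rn n → ℂ) (T : L2 n →L[ℂ] L2 n) : Prop where
  measurable : Measurable (Function.uncurry K)
  integrable : ∀ f : L2 n, ∀ᵐ x ∂(volume : Measure (Rn n)),
    Integrable (fun y => K x y * (f : Rn n → ℂ) y) volume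
  apply_eq : ∀ f : L2 n, ∀ᵐ x ∂(volume : Measure (Rn n)),
    (T f : Rn n → ℂ) x = ∫ y, K x y * (f : Rn n → ℂ) y

/-! ### Dyadic systems and the kernel assumption -/

/-- Smooth functions `φ_j`, `j ∈ ℤ`, with (i) `supp φ_j ⊆ {2^(j-2) ≤ |x| ≤ 2^j}` and
(ii) `|φ_j^(k)(x)| ≤ c_k 2^(-kj)` for all `j`, `k`, `x`. -/
structure IsDyadicFamily (φ : ℤ → ℝ → ℝ) : Prop where
  smooth : ∀ j, ContDiff ℝ ∞ (φ j)
  support : ∀ j, tsupport (φ j) ⊆ {x : ℝ | (2 : ℝ) ^ (j - 2) ≤ |x| ∧ |x| ≤ (2 : ℝ) ^ j}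
  deriv_bound : ∀ k : ℕ, ∃ c : ℝ, ∀ (j : ℤ) (x : ℝ),
    |iteratedDeriv k (φ j) x| ≤ c * (2 : ℝ) ^ (-((k : ℤ) * j))

/-- A dyadic system: (i), (ii) and (iii) `∑_j φ_j(x) ≈ c > 0` for `x ≠ 0`, that is, the sum
(which has at most three nonzero terms) lies between two positive constants. -/
structure IsDyadicSystem (φ : ℤ → ℝ → ℝ) : Prop extends IsDyadicFamily φ where
  sum_equiv : ∃ c₁ c₂ : ℝ, 0 < c₁ ∧ ∀ x : ℝ, x ≠ 0 →
    c₁ ≤ ∑' j : ℤ, φ j x ∧ ∑' j : ℤ, φ j x ≤ c₂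

/-- The decay assumption on `H`: for every family `φ_j` with (i) and (ii), the operators `φ_j(H)`
have kernels `φ_j(H)(x,y)`, differentiable in `x`, such that for every `N` there is `c_N` with
`|φ_j(H)(x,y)| ≤ c_N 2^(nj/2) / (1 + 2^(j/2)|x-y|)^N` and
`|∇_x φ_j(H)(x,y)| ≤ c_N 2^((n+1)j/2) / (1 + 2^(j/2)|x-y|)^N` for all `j`, `x`, `y`. -/
def KernelDecay {n : ℕ} (H : L2 n →ₗ.[ℂ] L2 n) : Prop :=
  ∀ φ : ℤ → ℝ → ℝ, IsDyadicFamily φ →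
    ∃ K : ℤ → Rn n → Rn n → ℂ,
      (∀ j, IsKernelOf (K j) (spectralOp H (φ j))) ∧
      (∀ j y, Differentiable ℝ (fun x => K j x y)) ∧
      ∀ N : ℕ, ∃ c : ℝ, 0 < c ∧ ∀ (j : ℤ) (x y : Rn n),
        ‖K j x y‖ ≤
          c * ((2 : ℝ) ^ ((n : ℝ) * j / 2) / (1 + (2 : ℝ) ^ ((j : ℝ) / 2) * ‖x - y‖) ^ N) ∧
        ‖fderiv ℝ (fun x' => K j x' y) x‖ ≤
          c * ((2 : ℝ) ^ (((n : ℝ) + 1) * j / 2) /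
            (1 + (2 : ℝ) ^ ((j : ℝ) / 2) * ‖x - y‖) ^ N)

/-! ### Peetre maximal functions and quasi-norms -/

open Classical in
/-- The continuous representative of a class in `L₂(ℝⁿ)` if there is one (it is then unique), and
an arbitrary representative otherwise. -/
def pointwiseRep {n : ℕ} (u : L2 n) : Rn n → ℂ :=
  if h : ∃ g : Rn n → ℂ, Continuous g ∧ (u : Rn n → ℂ) =ᵐ[volume] g then h.choose else u

/-- The function `φ(H) f` for a Schwartz function `f`. -/
def specFun {n : ℕ} (H : L2 n →ₗ.[ℂ] L2 n) (φ : ℝ → ℝ) (f : 𝓢(Rn n, ℂ)) : Rn n → ℂ :=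
  pointwiseRep (spectralOp H φ (f.toLp 2 volume))

/-- The Peetre maximal function
`φ*_{j,s} f (x) = sup_t |φ_j(H) f (t)| / (1 + 2^(j/2) |x - t|)^s`, with values in `[0,∞]`. -/
def peetreMax {n : ℕ} (H : L2 n →ₗ.[ℂ] L2 n) (φ : ℤ → ℝ → ℝ) (s : ℝ) (f : 𝓢(Rn n, ℂ))
    (j : ℤ) (x : Rn n) : ℝ≥0∞ :=
  ⨆ t : Rn n, ‖specFun H (φ j) f t‖ₑ /
    ENNReal.ofReal ((1 + (2 : ℝ) ^ ((j : ℝ) / 2) * ‖x - t‖) ^ s)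

/-- The `ℓ^q(L_p)` quasi-norm of `{2^(jα) g_j}`:
`(∑_j 2^(jαq) ‖g_j‖_p^q)^(1/q)`, with the supremum over `j` for `q = ∞`. -/
def lqLpNorm {n : ℕ} (p q : ℝ≥0∞) (α : ℝ) (g : ℤ → Rn n → ℝ≥0∞) : ℝ≥0∞ :=
  eLpNorm (fun j : ℤ => ENNReal.ofReal ((2 : ℝ) ^ ((j : ℝ) * α)) * eLpNorm (g j) p volume)
    q Measure.count

/-- The `L_p(ℓ^q)` quasi-norm of `{2^(jα) g_j}`:
`‖(∑_j 2^(jαq) g_j(·)^q)^(1/q)‖_p`, with the supremum over `j` for `q = ∞`. -/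
def LplqNorm {n : ℕ} (p q : ℝ≥0∞) (α : ℝ) (g : ℤ → Rn n → ℝ≥0∞) : ℝ≥0∞ :=
  eLpNorm (fun x : Rn n =>
      eLpNorm (fun j : ℤ => ENNReal.ofReal ((2 : ℝ) ^ ((j : ℝ) * α)) * g j x) q Measure.count)
    p volume

/-- The homogeneous Besov quasi-norm. -/
def besovNorm {n : ℕ} (H : L2 n →ₗ.[ℂ] L2 n) (φ : ℤ → ℝ → ℝ) (p q : ℝ≥0∞) (α : ℝ)
    (f : 𝓢(Rn n, ℂ)) : ℝ≥0∞ :=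
  lqLpNorm p q α (fun j x => ‖specFun H (φ j) f x‖ₑ)

/-- The homogeneous Triebel–Lizorkin quasi-norm. -/
def triebelLizorkinNorm {n : ℕ} (H : L2 n →ₗ.[ℂ] L2 n) (φ : ℤ → ℝ → ℝ) (p q : ℝ≥0∞) (α : ℝ)
    (f : 𝓢(Rn n, ℂ)) : ℝ≥0∞ :=
  LplqNorm p q α (fun j x => ‖specFun H (φ j) f x‖ₑ)

/-- `A ≈ B` on the Schwartz class: two-sided bounds with a finite constant independent of `f`. -/
def QuasiNormEquiv {n : ℕ} (A B : 𝓢(Rn n, ℂ) → ℝ≥0∞) : Prop :=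
  ∃ C : ℝ≥0, 0 < C ∧ ∀ f : 𝓢(Rn n, ℂ), A f ≤ C * B f ∧ B f ≤ C * A f

/-- A sequence of Schwartz functions of finite quasi-norm that is Cauchy for `A`. -/
def IsCauchyFor {n : ℕ} (A : 𝓢(Rn n, ℂ) → ℝ≥0∞) (u : ℕ → 𝓢(Rn n, ℂ)) : Prop :=
  (∀ k, A (u k) < ⊤) ∧ ∀ ε : ℝ≥0∞, 0 < ε → ∃ k₀, ∀ k ≥ k₀, ∀ l ≥ k₀, A (u k - u l) < ε

/-- `A` and `B` give the same completion of the Schwartz class (Cauchy sequences modulo null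
sequences): they have the same Cauchy sequences and identify the same pairs of them. -/
def SameCompletion {n : ℕ} (A B : 𝓢(Rn n, ℂ) → ℝ≥0∞) : Prop :=
  (∀ u, IsCauchyFor A u ↔ IsCauchyFor B u) ∧
  ∀ u v, IsCauchyFor A u → IsCauchyFor A v →
    (Tendsto (fun k => A (u k - v k)) atTop (𝓝 0) ↔
      Tendsto (fun k => B (u k - v k)) atTop (𝓝 0))

end SchrodingerLP

end

noncomputable section

namespace SchrodingerLP

/-! ### Inequalities in `[0,∞]` -/

/-! Write `k_a(x) = a^n (1 + a|x|)^(-λ)`, with `a = 2^(j/2)` at level `j`. Dividing a dyadic family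
by the sum of a dyadic system gives again a family with (i) and (ii)
(`isDyadicFamily_dyadicQuotient`). Hence `φ_j = ∑ θ_k φ_j` with `|k - j| ≤ 2` and `θ = φ / ∑ φ`, and
multiplicativity of the functional calculus together with the kernel decay of `θ_k(H)` gives the
reproducing inequality `|φ_j(H)f| ≤ c k_a * |φ_j(H)f|` with any large exponent `λ = N`
(`exists_enorm_specFun_le_peetreConv`).

This inequality improves itself. For `r ≤ 1` split `U = U^r U^(1-r)`, bound the second factor by the
Peetre maximal function and absorb; for `r > 1` use Jensen. The result, for every `r > 0`, is
`(φ*_{j,s} f)^r ≤ C k_a * |φ_j(H)f|^r` with `λ = s r` (`peetreSup_rpow_le`,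
`exists_peetreMax_rpow_le`).

When `s r > n` the kernels have a finite mass independent of `a`. Part a) for `p < ∞` is then
integration with `r = p`; for `p = ∞` it is immediate. Part b) needs a maximal inequality in
`L_{p/r}(ℓ^{q/r})` (`exists_eLpNorm_eLpNorm_le`). For `q ≤ p` take `r = q`: the inner norm is `ℓ^1`,
and duality with the scalar maximal theorem suffices. For `p < q` take `n/s < r < p`: if `q = ∞` the
scalar maximal theorem suffices, otherwise a majorant built by Rubio de Francia's algorithm serves
as a weight that reduces the inequality to one for a single function. The scalar theorem comes from
Vitali covering and Marcinkiewicz interpolation.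

For c), `φ_j = ∑ (φ_j / ∑ ψ) ψ_k` over `|k - j| ≤ 2` bounds `|φ_j(H)f|` by five neighbouring maximal
functions of `ψ` (`exists_enorm_specFun_le_sum_peetreMax`). The characterizations a), b) for `ψ`
turn this into a bound by the quasi-norm of `ψ`, and the roles can be exchanged. -/

lemma rpow_mul_rpow_neg_le_one (x : ℝ≥0∞) (a : ℝ) : x ^ a * x ^ (-a) ≤ 1 := by
  rw [ENNReal.rpow_neg]; exact ENNReal.mul_inv_le_one _

/-- Only an inequality survives for `b < 0`: at `x = ⊤` the left side is `⊤ * 0 = 0`. -/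
lemma rpow_mul_rpow_le {a b : ℝ} (ha : 0 ≤ a) (hab : 0 < a + b) (x : ℝ≥0∞) :
    x ^ a * x ^ b ≤ x ^ (a + b) := by
  rcases eq_or_ne x 0 with rfl | h0
  · rcases ha.eq_or_lt with rfl | ha
    · simp
    · simp [ENNReal.zero_rpow_of_pos ha]
  rcases eq_or_ne x ⊤ with rfl | ht
  · simp [ENNReal.top_rpow_of_pos hab]
  · rw [ENNReal.rpow_add _ _ h0 ht]

/-- Jensen's inequality for a power `r ≥ 1` and a finite (not normalized) measure. -/
lemma lintegral_rpow_le_measure_univ_mul {α : Type*} [MeasurableSpace α] (μ : Measure α) {r : ℝ}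
    (hr : 1 ≤ r) {g : α → ℝ≥0∞} (hg : AEMeasurable g μ) :
    (∫⁻ x, g x ∂μ) ^ r ≤ μ Set.univ ^ (r - 1) * ∫⁻ x, g x ^ r ∂μ := by
  rcases hr.eq_or_lt with rfl | hr
  · simp
  have hpq : r.HolderConjugate (r / (r - 1)) := Real.HolderConjugate.conjExponent hr
  have h := ENNReal.lintegral_mul_le_Lp_mul_Lq μ hpq hg (aemeasurable_const (b := (1 : ℝ≥0∞)))
  simp only [Pi.mul_apply, mul_one, ENNReal.one_rpow, lintegral_const, one_mul] at h
  calc (∫⁻ x, g x ∂μ) ^ r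
      ≤ ((∫⁻ x, g x ^ r ∂μ) ^ (1 / r) * μ Set.univ ^ (1 / (r / (r - 1)))) ^ r := by gcongr
    _ = _ := by
      rw [ENNReal.mul_rpow_of_nonneg _ _ (by linarith), ← ENNReal.rpow_mul, ← ENNReal.rpow_mul,
        mul_comm]
      have h1 : r ≠ 0 := by linarith
      have h2 : r - 1 ≠ 0 := by linarith
      congr 2
      · field_simp
      · rw [one_div_mul_cancel h1, ENNReal.rpow_one]

/-- The same for weighted integrals `∫ k g`. -/
lemma lintegral_mul_rpow_le {α : Type*} [MeasurableSpace α] (μ : Measure α) {r : ℝ}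
    (hr : 1 ≤ r) {k g : α → ℝ≥0∞} (hk : Measurable k) (hg : Measurable g) :
    (∫⁻ x, k x * g x ∂μ) ^ r ≤ (∫⁻ x, k x ∂μ) ^ (r - 1) * ∫⁻ x, k x * g x ^ r ∂μ := by
  have h := lintegral_rpow_le_measure_univ_mul (μ.withDensity k) hr hg.aemeasurable
  rwa [lintegral_withDensity_eq_lintegral_mul _ hk hg,
    lintegral_withDensity_eq_lintegral_mul _ hk (hg.pow_const r), withDensity_apply _ .univ,
    Measure.restrict_univ] at h

/-- The layer cake formula for a single number. -/
lemma rpow_eq_lintegral_Ioi {p : ℝ} (hp : 0 < p) (y : ℝ≥0∞) :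
    y ^ p = ∫⁻ t in Set.Ioi (0 : ℝ), ENNReal.ofReal (p * t ^ (p - 1)) *
      {t : ℝ | ENNReal.ofReal t < y}.indicator 1 t := by
  have hfin : ∀ b : ℝ, 0 ≤ b → ENNReal.ofReal b ^ p =
      ∫⁻ t in Set.Ioi (0 : ℝ), ENNReal.ofReal (p * t ^ (p - 1)) *
        {t : ℝ | ENNReal.ofReal t < ENNReal.ofReal b}.indicator 1 t := by
    intro b hb
    -- The usual layer cake formula on a one-point space.
    have h := lintegral_rpow_eq_lintegral_meas_lt_mul (Measure.dirac ()) (f := fun _ => b)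
      (Eventually.of_forall fun _ => hb) aemeasurable_const hp
    simp only [lintegral_dirac] at h
    rw [ENNReal.ofReal_rpow_of_nonneg hb hp.le, h, ← lintegral_const_mul']
    · refine setLIntegral_congr_fun measurableSet_Ioi fun t ht => ?_
      have ht : 0 < t := ht
      simp only [ENNReal.ofReal_mul hp.le]
      rw [mul_comm (Measure.dirac () _), mul_assoc]
      congr 2
      by_cases htb : t < b
      · have : ENNReal.ofReal t < ENNReal.ofReal b :=
          (ENNReal.ofReal_lt_ofReal_iff (ht.trans htb)).2 htb
        simp [htb, this]
      · have : ¬ ENNReal.ofReal t < ENNReal.ofReal b :=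
          not_lt.2 (ENNReal.ofReal_le_ofReal (not_lt.1 htb))
        simp [htb, this]
    · exact ENNReal.ofReal_ne_top
  rcases eq_or_ne y ⊤ with rfl | hy
  · rw [ENNReal.top_rpow_of_pos hp]
    symm
    rw [eq_top_iff]
    refine le_of_forall_lt fun c hc => ?_
    obtain ⟨b, hb, hcb⟩ : ∃ b : ℝ, 0 ≤ b ∧ c < ENNReal.ofReal b ^ p := by
      refine ⟨(c.toReal + 1) ^ (1 / p), by positivity, ?_⟩
      rw [ENNReal.ofReal_rpow_of_nonneg (by positivity) hp.le, ← Real.rpow_mul (by positivity),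
        one_div_mul_cancel hp.ne', Real.rpow_one,
        ENNReal.lt_ofReal_iff_toReal_lt hc.ne]
      linarith
    refine hcb.trans_le ?_
    rw [hfin b hb]
    gcongr with t
    exact le_top
  · have := hfin y.toReal ENNReal.toReal_nonneg
    rwa [ENNReal.ofReal_toReal hy] at this

/-! ### The kernels `a^n (1 + a|x|)^(-λ)` -/

/-- The `L₁`-normalized kernel `a^n (1 + a|x|)^(-λ)`. -/
def peetreKernel {n : ℕ} (a lam : ℝ) (x : Rn n) : ℝ≥0∞ :=
  ENNReal.ofReal (a ^ n * (1 + a * ‖x‖) ^ (-lam))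

/-- Convolution with `peetreKernel`. -/
def peetreConv {n : ℕ} (a lam : ℝ) (g : Rn n → ℝ≥0∞) (x : Rn n) : ℝ≥0∞ :=
  ∫⁻ y, peetreKernel a lam (x - y) * g y

/-- The integral of `peetreKernel`, which does not depend on `a`. -/
def peetreMass (n : ℕ) (lam : ℝ) : ℝ≥0∞ := ∫⁻ x : Rn n, peetreKernel 1 lam x

variable {n : ℕ}

@[fun_prop]
lemma measurable_peetreKernel (a lam : ℝ) : Measurable (peetreKernel (n := n) a lam) := by
  unfold peetreKernel; fun_prop

lemma peetreKernel_sub_comm (a lam : ℝ) (x y : Rn n) :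
    peetreKernel a lam (x - y) = peetreKernel a lam (y - x) := by
  simp only [peetreKernel, norm_sub_rev]

lemma lintegral_peetreKernel {a : ℝ} (ha : 0 < a) (lam : ℝ) :
    ∫⁻ x : Rn n, peetreKernel a lam x = peetreMass n lam := by
  have h := Measure.map_addHaar_smul (volume : Measure (Rn n)) ha.ne'
  rw [finrank_euclideanSpace_fin] at h
  have h2 : ∫⁻ x : Rn n, peetreKernel 1 lam (a • x) =
      ENNReal.ofReal |(a ^ n)⁻¹| * peetreMass n lam := by
    rw [← lintegral_map (measurable_peetreKernel 1 lam) (measurable_const_smul a), h,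
      lintegral_smul_measure]; rfl
  have h3 : ∀ x : Rn n, peetreKernel a lam x =
      ENNReal.ofReal (a ^ n) * peetreKernel 1 lam (a • x) := by
    intro x
    simp only [peetreKernel, norm_smul, Real.norm_of_nonneg ha.le, one_pow, one_mul]
    rw [ENNReal.ofReal_mul (by positivity)]
  simp_rw [h3]
  rw [lintegral_const_mul _ (by fun_prop), h2, ← mul_assoc, abs_of_pos (by positivity),
    ← ENNReal.ofReal_mul (by positivity), mul_inv_cancel₀ (by positivity)]
  simp

lemma peetreMass_lt_top {lam : ℝ} (h : (n : ℝ) < lam) : peetreMass n lam < ⊤ := by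
  have := finite_integral_one_add_norm (E := Rn n) (μ := volume) (r := lam) (by simpa using h)
  simpa [peetreMass, peetreKernel] using this

lemma lintegral_peetreKernel_sub_left {a : ℝ} (ha : 0 < a) (lam : ℝ) (x : Rn n) :
    ∫⁻ y : Rn n, peetreKernel a lam (x - y) = peetreMass n lam := by
  rw [lintegral_sub_left_eq_self (fun y => peetreKernel a lam y) x, lintegral_peetreKernel ha]

@[fun_prop]
lemma measurable_peetreConv (a lam : ℝ) {g : Rn n → ℝ≥0∞} (hg : Measurable g) :
    Measurable (peetreConv a lam g) := by
  unfold peetreConv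
  exact Measurable.lintegral_prod_right' (f := fun z : Rn n × Rn n =>
    peetreKernel a lam (z.1 - z.2) * g z.2) (by fun_prop)

lemma peetreConv_mono (a lam : ℝ) {g h : Rn n → ℝ≥0∞} (H : ∀ᵐ x, g x ≤ h x) (x : Rn n) :
    peetreConv a lam g x ≤ peetreConv a lam h x := by
  refine lintegral_mono_ae ?_
  filter_upwards [H] with y hy
  gcongr

lemma peetreConv_const_mul (a lam : ℝ) (c : ℝ≥0∞) {g : Rn n → ℝ≥0∞} (hg : Measurable g)
    (x : Rn n) : peetreConv a lam (fun y => c * g y) x = c * peetreConv a lam g x := by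
  unfold peetreConv
  rw [← lintegral_const_mul _ (by fun_prop)]
  congr 1; ext y; ring

lemma peetreConv_const {a : ℝ} (ha : 0 < a) (lam : ℝ) (c : ℝ≥0∞) (x : Rn n) :
    peetreConv a lam (fun _ => c) x = peetreMass n lam * c := by
  unfold peetreConv
  rw [lintegral_mul_const _ (by fun_prop), lintegral_peetreKernel_sub_left ha]

lemma peetreConv_add (a lam : ℝ) {g h : Rn n → ℝ≥0∞} (hg : Measurable g) (x : Rn n) :
    peetreConv a lam (fun y => g y + h y) x = peetreConv a lam g x + peetreConv a lam h x := by
  unfold peetreConv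
  simp_rw [mul_add]
  rw [lintegral_add_left (by fun_prop)]

lemma peetreConv_tsum {ι : Type*} [Countable ι] (a lam : ℝ) {g : ι → Rn n → ℝ≥0∞}
    (hg : ∀ i, Measurable (g i)) (x : Rn n) :
    peetreConv a lam (fun y => ∑' i, g i y) x = ∑' i, peetreConv a lam (g i) x := by
  unfold peetreConv
  simp_rw [← ENNReal.tsum_mul_left]
  rw [lintegral_tsum fun i => by fun_prop]

/-- Tonelli and evenness of the kernel. This symmetry is what makes the duality argument for sums of
convolutions work. -/
lemma lintegral_peetreConv_mul (a lam : ℝ) {g w : Rn n → ℝ≥0∞} (hg : Measurable g)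
    (hw : Measurable w) :
    ∫⁻ x, peetreConv a lam g x * w x = ∫⁻ x, g x * peetreConv a lam w x := by
  unfold peetreConv
  calc ∫⁻ x, (∫⁻ y, peetreKernel a lam (x - y) * g y) * w x
      = ∫⁻ x, ∫⁻ y, peetreKernel a lam (x - y) * g y * w x := by
        congr 1; ext x; rw [lintegral_mul_const _ (by fun_prop)]
    _ = ∫⁻ y, ∫⁻ x, peetreKernel a lam (x - y) * g y * w x :=
        lintegral_lintegral_swap (by unfold Function.uncurry; fun_prop)
    _ = _ := by
        congr 1; ext y
        rw [← lintegral_const_mul _ (by fun_prop)]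
        congr 1; ext x; rw [peetreKernel_sub_comm]; ring

lemma lintegral_peetreConv {a : ℝ} (ha : 0 < a) (lam : ℝ) {g : Rn n → ℝ≥0∞} (hg : Measurable g) :
    ∫⁻ x, peetreConv a lam g x = peetreMass n lam * ∫⁻ x, g x := by
  have := lintegral_peetreConv_mul a lam hg (measurable_const (a := (1 : ℝ≥0∞)))
  simp only [peetreConv_const ha, mul_one] at this
  rw [this, lintegral_mul_const _ hg, mul_comm]

lemma peetreConv_rpow_le {a : ℝ} (ha : 0 < a) (lam : ℝ) {r : ℝ} (hr : 1 ≤ r)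
    {g : Rn n → ℝ≥0∞} (hg : Measurable g) (x : Rn n) :
    peetreConv a lam g x ^ r ≤ peetreMass n lam ^ (r - 1) *
      peetreConv a lam (fun y => g y ^ r) x := by
  have := lintegral_mul_rpow_le volume hr
    (k := fun y => peetreKernel a lam (x - y)) (by fun_prop) hg
  rwa [lintegral_peetreKernel_sub_left ha] at this

/-- Jensen for a concave power, obtained from the convex case with exponent `1 / θ` applied to `g ^
θ`. -/
lemma peetreConv_rpow_le_of_le_one {a : ℝ} (ha : 0 < a) (lam : ℝ) {θ : ℝ} (h0 : 0 < θ)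
    (h1 : θ ≤ 1) {g : Rn n → ℝ≥0∞} (hg : Measurable g) (x : Rn n) :
    peetreConv a lam (fun y => g y ^ θ) x ≤
      peetreMass n lam ^ (1 - θ) * peetreConv a lam g x ^ θ := by
  have := peetreConv_rpow_le ha lam (one_le_one_div h0 h1) (hg.pow_const θ) x
  simp only [← ENNReal.rpow_mul, mul_one_div_cancel h0.ne', ENNReal.rpow_one] at this
  rw [← ENNReal.rpow_le_rpow_iff (z := 1 / θ) (by positivity)]
  refine this.trans_eq ?_
  rw [ENNReal.mul_rpow_of_nonneg _ _ (by positivity), ← ENNReal.rpow_mul, ← ENNReal.rpow_mul,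
    mul_one_div_cancel h0.ne', ENNReal.rpow_one]
  congr 2
  field_simp

lemma one_add_mul_norm_sub_le {a : ℝ} (ha : 0 ≤ a) (x y t : Rn n) :
    1 + a * ‖x - y‖ ≤ (1 + a * ‖x - t‖) * (1 + a * ‖t - y‖) := by
  have h : ‖x - y‖ ≤ ‖x - t‖ + ‖t - y‖ := norm_sub_le_norm_sub_add_norm_sub x t y
  have h1 := mul_le_mul_of_nonneg_left h ha
  have h2 : 0 ≤ (a * ‖x - t‖) * (a * ‖t - y‖) := by positivity
  nlinarith

/-! ### The Hardy–Littlewood maximal function -/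

/-- The centred Hardy–Littlewood maximal function (up to the volume of the unit ball). -/
def hlMax (g : Rn n → ℝ≥0∞) (x : Rn n) : ℝ≥0∞ :=
  ⨆ (ρ : ℝ) (_ : 0 < ρ), (ENNReal.ofReal (ρ ^ n))⁻¹ * ∫⁻ y in Metric.closedBall x ρ, g y

lemma setLIntegral_closedBall_le_hlMax (g : Rn n → ℝ≥0∞) (x : Rn n) {ρ : ℝ} (hρ : 0 < ρ) :
    ∫⁻ y in Metric.closedBall x ρ, g y ≤ ENNReal.ofReal (ρ ^ n) * hlMax g x := by
  have h : (ENNReal.ofReal (ρ ^ n))⁻¹ * ∫⁻ y in Metric.closedBall x ρ, g y ≤ hlMax g x :=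
    le_iSup₂ (f := fun (ρ : ℝ) (_ : 0 < ρ) =>
      (ENNReal.ofReal (ρ ^ n))⁻¹ * ∫⁻ y in Metric.closedBall x ρ, g y) ρ hρ
  have h0 : ENNReal.ofReal (ρ ^ n) ≠ 0 := by simpa using (pow_pos hρ n)
  calc ∫⁻ y in Metric.closedBall x ρ, g y
      = ENNReal.ofReal (ρ ^ n) * ((ENNReal.ofReal (ρ ^ n))⁻¹ *
          ∫⁻ y in Metric.closedBall x ρ, g y) := by
        rw [← mul_assoc, ENNReal.mul_inv_cancel h0 ENNReal.ofReal_ne_top, one_mul]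
    _ ≤ _ := by gcongr

/-- For the least `i` with `z ≤ 2^i`, either `i = 0` or `z > 2^(i-1)`, so `1 + z ≥ 2^i / 2` and the
`i`-th term alone dominates; `2^lam` pays for the factor `1/2`. -/
lemma one_add_rpow_neg_le_tsum {lam : ℝ} (hlam : 0 ≤ lam) {z : ℝ} (hz : 0 ≤ z) :
    ENNReal.ofReal ((1 + z) ^ (-lam)) ≤ ∑' i : ℕ,
      ENNReal.ofReal (2 ^ lam * ((2 : ℝ) ^ i) ^ (-lam)) * {z : ℝ | z ≤ 2 ^ i}.indicator 1 z := by
  have hex : ∃ i : ℕ, z ≤ 2 ^ i := by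
    obtain ⟨i, hi⟩ := pow_unbounded_of_one_lt z (one_lt_two : (1 : ℝ) < 2)
    exact ⟨i, hi.le⟩
  classical
  have hi := Nat.find_spec hex
  refine le_trans ?_ (ENNReal.le_tsum (Nat.find hex))
  rw [Set.indicator_of_mem (by exact hi)]
  simp only [Pi.one_apply, mul_one]
  refine ENNReal.ofReal_le_ofReal ?_
  have h2 : (2 : ℝ) ^ lam = (2⁻¹ : ℝ) ^ (-lam) := by
    rw [Real.inv_rpow (by norm_num), Real.rpow_neg (by norm_num), inv_inv]
  rw [h2, ← Real.mul_rpow (by norm_num) (by positivity)]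
  refine Real.rpow_le_rpow_of_nonpos (by positivity) ?_ (by linarith)
  rcases Nat.eq_zero_or_pos (Nat.find hex) with h | h
  · rw [h]; norm_num; linarith
  · have := Nat.find_min hex (Nat.sub_one_lt_of_lt h)
    obtain ⟨m, hm⟩ := Nat.exists_eq_add_of_lt h
    rw [hm] at this ⊢
    simp only [zero_add, add_tsub_cancel_right, not_le] at this
    rw [zero_add, pow_succ]; linarith

/-- Slice the kernel over the balls of radius `2^i / a`. The `i`-th slice costs `2^(-i lam)` and
gains the volume factor `2^(i n)`; the powers of `a` cancel, and the geometric series converges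
because `lam > n`. -/
lemma exists_peetreConv_le_hlMax {lam : ℝ} (hlam : (n : ℝ) < lam) :
    ∃ C : ℝ≥0∞, C ≠ ⊤ ∧ ∀ a : ℝ, 0 < a → ∀ g : Rn n → ℝ≥0∞, Measurable g → ∀ x,
      peetreConv a lam g x ≤ C * hlMax g x := by
  have hlam0 : 0 ≤ lam := (Nat.cast_nonneg n).trans hlam.le
  refine ⟨∑' i : ℕ, ENNReal.ofReal (2 ^ lam) * ENNReal.ofReal (2 ^ ((n : ℝ) - lam)) ^ i, ?_, ?_⟩
  · rw [ENNReal.tsum_mul_left, ENNReal.tsum_geometric]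
    refine ENNReal.mul_ne_top ENNReal.ofReal_ne_top (ENNReal.inv_ne_top.2 ?_)
    rw [Ne, tsub_eq_zero_iff_le, not_le, ENNReal.ofReal_lt_one]
    exact Real.rpow_lt_one_of_one_lt_of_neg one_lt_two (by linarith)
  · intro a ha g hg x
    calc peetreConv a lam g x
        ≤ ∫⁻ y, ∑' i : ℕ, ENNReal.ofReal (a ^ n * (2 ^ lam * ((2 : ℝ) ^ i) ^ (-lam))) *
            (Metric.closedBall x (2 ^ i / a)).indicator g y := by
          refine lintegral_mono fun y => ?_
          have h := one_add_rpow_neg_le_tsum hlam0 (z := a * ‖x - y‖) (by positivity)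
          rw [peetreKernel, ENNReal.ofReal_mul (by positivity)]
          calc _ ≤ ENNReal.ofReal (a ^ n) * (∑' i : ℕ,
                ENNReal.ofReal (2 ^ lam * ((2 : ℝ) ^ i) ^ (-lam)) *
                  {z : ℝ | z ≤ 2 ^ i}.indicator 1 (a * ‖x - y‖)) * g y := by gcongr
            _ = _ := by
              rw [← ENNReal.tsum_mul_left, ← ENNReal.tsum_mul_right]
              congr 1; ext i
              rw [ENNReal.ofReal_mul (p := a ^ n) (by positivity), mul_assoc, mul_assoc, mul_assoc]
              congr 2
              have : a * ‖x - y‖ ≤ 2 ^ i ↔ y ∈ Metric.closedBall x (2 ^ i / a) := by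
                rw [mem_closedBall_iff_norm', le_div_iff₀ ha, mul_comm]
              by_cases hy : y ∈ Metric.closedBall x (2 ^ i / a)
              · rw [Set.indicator_of_mem hy, Set.indicator_of_mem (by exact this.2 hy)]; simp
              · rw [Set.indicator_of_notMem hy,
                  Set.indicator_of_notMem (by exact fun h => hy (this.1 h))]; simp
      _ = ∑' i : ℕ, ENNReal.ofReal (a ^ n * (2 ^ lam * ((2 : ℝ) ^ i) ^ (-lam))) *
            ∫⁻ y in Metric.closedBall x (2 ^ i / a), g y := by
          rw [lintegral_tsum fun i =>
            ((hg.indicator measurableSet_closedBall).const_mul _).aemeasurable]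
          congr 1; ext i
          rw [lintegral_const_mul _ (hg.indicator measurableSet_closedBall),
            lintegral_indicator measurableSet_closedBall]
      _ ≤ ∑' i : ℕ, ENNReal.ofReal (a ^ n * (2 ^ lam * ((2 : ℝ) ^ i) ^ (-lam))) *
            (ENNReal.ofReal ((2 ^ i / a) ^ n) * hlMax g x) := by
          gcongr with i
          exact setLIntegral_closedBall_le_hlMax g x (by positivity)
      _ = _ := by
          rw [← ENNReal.tsum_mul_right]
          congr 1; ext i
          rw [← mul_assoc, ← ENNReal.ofReal_mul (by positivity), ← ENNReal.ofReal_pow (by positivity),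
            ← ENNReal.ofReal_mul (by positivity)]
          congr 2
          rw [Real.rpow_sub (by norm_num), Real.rpow_natCast, Real.rpow_neg (by positivity), div_pow,
            div_pow, ← Real.rpow_natCast (2 ^ lam) i, ← Real.rpow_natCast 2 i, ← Real.rpow_mul (by norm_num),
            ← Real.rpow_mul (by norm_num), mul_comm lam, ← Real.rpow_natCast (2 ^ (i:ℝ)) n,
            ← Real.rpow_mul (by norm_num),  ← Real.rpow_natCast (2 ^ n) i, ← Real.rpow_natCast 2 n,
            ← Real.rpow_mul (by norm_num), mul_comm (n:ℝ)]
          field_simp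

/-- The weak type `(1,1)` inequality. -/
lemma exists_volume_lt_hlMax_le (hn : 0 < n) :
    ∃ C : ℝ≥0∞, C ≠ ⊤ ∧ ∀ g : Rn n → ℝ≥0∞, ∀ t : ℝ≥0∞, t ≠ 0 → t ≠ ⊤ →
      volume {x | t < hlMax g x} ≤ C / t * ∫⁻ x, g x := by
  refine ⟨ENNReal.ofReal (4 ^ n) * volume (Metric.ball (0 : Rn n) 1),
    ENNReal.mul_ne_top ENNReal.ofReal_ne_top measure_ball_lt_top.ne, fun g t ht0 ht => ?_⟩
  set B := volume (Metric.ball (0 : Rn n) 1)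
  have hB0 : B ≠ 0 := (Metric.measure_ball_pos _ _ one_pos).ne'
  rcases eq_or_ne (∫⁻ x, g x) ⊤ with htop | hfin
  · rw [htop, ENNReal.mul_top]
    · exact le_top
    · refine (ENNReal.div_pos (mul_ne_zero ?_ hB0) ht).ne'
      simp
  have hsel : ∀ x ∈ {x | t < hlMax g x}, ∃ ρ : ℝ, 0 < ρ ∧
      t * ENNReal.ofReal (ρ ^ n) ≤ ∫⁻ y in Metric.closedBall x ρ, g y := by
    intro x hx
    rw [Set.mem_ofPred_eq, hlMax] at hx
    obtain ⟨ρ, hx⟩ := lt_iSup_iff.1 hx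
    obtain ⟨hρ, hx⟩ := lt_iSup_iff.1 hx
    refine ⟨ρ, hρ, ?_⟩
    rw [← ENNReal.div_eq_inv_mul] at hx
    exact ENNReal.mul_le_of_le_div hx.le
  choose! ρ hρ0 hρ using hsel
  -- Vitali's lemma needs bounded radii. The selection gives `ρ^n ≤ ∫ g / t`, and `ρ ≤ ρ^n` for `ρ ≥
  -- 1` because `n ≠ 0`.
  have hbdd : ∀ x ∈ {x | t < hlMax g x}, ρ x ≤ max 1 ((∫⁻ x, g x) / t).toReal := by
    intro x hx
    rcases le_total (ρ x) 1 with h1 | h1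
    · exact h1.trans (le_max_left _ _)
    · refine le_trans ?_ (le_max_right _ _)
      have h2 : ENNReal.ofReal (ρ x ^ n) ≤ (∫⁻ x, g x) / t := by
        rw [ENNReal.le_div_iff_mul_le (Or.inl ht0) (Or.inl ht), mul_comm]
        exact (hρ x hx).trans (setLIntegral_le_lintegral _ _)
      have h3 := (ENNReal.ofReal_le_iff_le_toReal (ENNReal.div_ne_top hfin ht0)).1 h2
      exact (le_self_pow₀ h1 hn.ne').trans h3
  -- Any enlargement factor above `3` is admissible; `4` produces the `4 ^ n` in the constant.
  obtain ⟨u, huS, hdisj, hcov⟩ := Vitali.exists_disjoint_subfamily_covering_enlargement_closedBall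
    {x | t < hlMax g x} id ρ _ hbdd 4 (by norm_num)
  simp only [id] at hdisj hcov
  have hcount : u.Countable := by
    refine hdisj.countable_of_nonempty_interior fun x hx => ?_
    exact ⟨x, Metric.ball_subset_interior_closedBall (Metric.mem_ball_self (hρ0 x (huS hx)))⟩
  have hvol : ∀ x ∈ u, volume (Metric.closedBall x (4 * ρ x)) ≤
      ENNReal.ofReal (4 ^ n) * B / t * ∫⁻ y in Metric.closedBall x (ρ x), g y := by
    intro x hx
    have h0 := hρ0 x (huS hx)
    rw [Measure.addHaar_closedBall _ _ (by positivity), finrank_euclideanSpace_fin, mul_pow,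
      ENNReal.ofReal_mul (by positivity)]
    calc _ = ENNReal.ofReal (4 ^ n) * B / t * (t * ENNReal.ofReal (ρ x ^ n)) := by
          rw [← mul_assoc, ENNReal.div_mul_cancel ht0 ht]
          ring
      _ ≤ _ := by gcongr; exact hρ x (huS hx)
  calc volume {x | t < hlMax g x}
      ≤ volume (⋃ x ∈ u, Metric.closedBall x (4 * ρ x)) := by
        refine measure_mono fun x hx => ?_
        obtain ⟨b, hb, hsub⟩ := hcov x hx
        exact Set.mem_biUnion hb (hsub (Metric.mem_closedBall_self (hρ0 x hx).le))
    _ ≤ ∑' x : u, volume (Metric.closedBall (x : Rn n) (4 * ρ x)) := measure_biUnion_le _ hcount _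
    _ ≤ ∑' x : u, ENNReal.ofReal (4 ^ n) * B / t *
          ∫⁻ y in Metric.closedBall (x : Rn n) (ρ x), g y :=
        ENNReal.tsum_le_tsum fun x => hvol x x.2
    _ = ENNReal.ofReal (4 ^ n) * B / t * ∫⁻ y in ⋃ x ∈ u, Metric.closedBall x (ρ x), g y := by
        rw [ENNReal.tsum_mul_left,
          lintegral_biUnion hcount (fun _ _ => measurableSet_closedBall) hdisj]
    _ ≤ _ := by gcongr; exact Measure.restrict_le_self

/-- The maximal function of the convolutions with the kernels `peetreKernel (2^(j/2)) λ`. -/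
def peetreConvMax (lam : ℝ) (g : Rn n → ℝ≥0∞) (x : Rn n) : ℝ≥0∞ :=
  ⨆ j : ℤ, peetreConv ((2 : ℝ) ^ ((j : ℝ) / 2)) lam g x

@[fun_prop]
lemma measurable_peetreConvMax (lam : ℝ) {g : Rn n → ℝ≥0∞} (hg : Measurable g) :
    Measurable (peetreConvMax lam g) :=
  Measurable.iSup fun _ => measurable_peetreConv _ _ hg

lemma peetreConv_le_peetreConvMax (lam : ℝ) (g : Rn n → ℝ≥0∞) (j : ℤ) (x : Rn n) :
    peetreConv ((2 : ℝ) ^ ((j : ℝ) / 2)) lam g x ≤ peetreConvMax lam g x :=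
  le_iSup (fun j : ℤ => peetreConv ((2 : ℝ) ^ ((j : ℝ) / 2)) lam g x) j

lemma two_rpow_half_pos (j : ℤ) : 0 < (2 : ℝ) ^ ((j : ℝ) / 2) := by positivity

/-- Split `g` at height `κ t`. The low part contributes at most its height times the kernel mass, so
only the high part has to be fed into the weak type bound. Having only the high part on the right is
what permits integration over `t` afterwards. -/
lemma exists_volume_lt_peetreConvMax_le (hn : 0 < n) {lam : ℝ} (hlam : (n : ℝ) < lam) :
    ∃ C : ℝ≥0∞, C ≠ ⊤ ∧ ∃ κ : ℝ, 0 < κ ∧ ∀ g : Rn n → ℝ≥0∞, Measurable g → ∀ t : ℝ, 0 < t →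
      volume {x | ENNReal.ofReal t < peetreConvMax lam g x} ≤
        C / ENNReal.ofReal t * ∫⁻ x in {x | ENNReal.ofReal (κ * t) < g x}, g x := by
  obtain ⟨C₁, hC₁, hweak⟩ := exists_volume_lt_hlMax_le hn
  obtain ⟨C₀, hC₀, hdom⟩ := exists_peetreConv_le_hlMax hlam
  have hA := peetreMass_lt_top hlam
  set A := peetreMass n lam with hAdef
  -- `D` and `κ` make the contributions of the high and low parts at most `t / 2` each; the `+ 1`
  -- keeps the denominators positive.
  set D : ℝ := 2 * (C₀.toReal + 1)
  have hD : 0 < D := by positivity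
  set κ : ℝ := 1 / (2 * (A.toReal + 1))
  have hκ : 0 < κ := by positivity
  refine ⟨C₁ * ENNReal.ofReal D, ENNReal.mul_ne_top hC₁ ENNReal.ofReal_ne_top, κ, hκ,
    fun g hg t ht => ?_⟩
  set S := {x | ENNReal.ofReal (κ * t) < g x}
  have hS : MeasurableSet S := measurableSet_lt measurable_const hg
  have hsub : {x | ENNReal.ofReal t < peetreConvMax lam g x} ⊆
      {x | ENNReal.ofReal (t / D) < hlMax (S.indicator g) x} := by
    intro x hx
    rw [Set.mem_ofPred_eq, peetreConvMax] at hx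
    obtain ⟨j, hj⟩ := lt_iSup_iff.1 hx
    by_contra hcon
    have hcon : hlMax (S.indicator g) x ≤ ENNReal.ofReal (t / D) := not_lt.1 hcon
    refine absurd hj (not_lt.2 ?_)
    calc _ ≤ peetreConv ((2 : ℝ) ^ ((j : ℝ) / 2)) lam
            (fun y => S.indicator g y + ENNReal.ofReal (κ * t)) x := by
          refine peetreConv_mono _ _ (Eventually.of_forall fun y => ?_) x
          by_cases hy : y ∈ S
          · rw [Set.indicator_of_mem hy]; exact le_self_add
          · exact (not_lt.1 hy).trans le_add_self
      _ ≤ C₀ * ENNReal.ofReal (t / D) + A * ENNReal.ofReal (κ * t) := by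
          rw [peetreConv_add _ _ (hg.indicator hS), peetreConv_const (two_rpow_half_pos j)]
          gcongr
          exact (hdom _ (two_rpow_half_pos j) _ (hg.indicator hS) x).trans (by gcongr)
      _ = ENNReal.ofReal (C₀.toReal * (t / D) + A.toReal * (κ * t)) := by
          rw [ENNReal.ofReal_add (by positivity) (by positivity), ENNReal.ofReal_mul (p := C₀.toReal) (by positivity),
            ENNReal.ofReal_mul (p := A.toReal) (by positivity), ENNReal.ofReal_toReal hC₀,
            ENNReal.ofReal_toReal hA.ne]
      _ ≤ ENNReal.ofReal t := by
          refine ENNReal.ofReal_le_ofReal ?_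
          have h1 : C₀.toReal * (t / D) ≤ t / 2 := by
            rw [mul_div_assoc', div_le_div_iff₀ hD two_pos]
            have : 0 ≤ t := ht.le
            simp only [D]; nlinarith
          have h2 : A.toReal * (κ * t) ≤ t / 2 := by
            have : A.toReal * (κ * t) = A.toReal * t / (2 * (A.toReal + 1)) := by
              simp only [κ]; ring
            rw [this, div_le_div_iff₀ (by positivity) two_pos]
            nlinarith
          linarith
  calc _ ≤ _ := measure_mono hsub
    _ ≤ C₁ / ENNReal.ofReal (t / D) * ∫⁻ x, S.indicator g x :=
        hweak _ _ (by simpa using div_pos ht hD) ENNReal.ofReal_ne_top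
    _ = _ := by
        rw [lintegral_indicator hS, ENNReal.ofReal_div_of_pos hD, ENNReal.div_eq_inv_mul,
          ENNReal.inv_div (Or.inl ENNReal.ofReal_ne_top) (Or.inl (by simpa using hD))]
        congr 1
        rw [ENNReal.div_eq_inv_mul, ENNReal.div_eq_inv_mul]; ring

/-- The strong type `(P,P)` inequality, `1 < P < ∞`. -/
lemma exists_lintegral_peetreConvMax_rpow_le (hn : 0 < n) {lam : ℝ} (hlam : (n : ℝ) < lam)
    {P : ℝ} (hP : 1 < P) :
    ∃ C : ℝ≥0∞, C ≠ ⊤ ∧ ∀ g : Rn n → ℝ≥0∞, Measurable g →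
      ∫⁻ x, peetreConvMax lam g x ^ P ≤ C * ∫⁻ x, g x ^ P := by
  obtain ⟨C, hC, κ, hκ, hweak⟩ := exists_volume_lt_peetreConvMax_le hn hlam
  have hP0 : 0 < P := by linarith
  have hP1 : 0 < P - 1 := by linarith
  refine ⟨C * ENNReal.ofReal (P / (P - 1)) * ENNReal.ofReal κ⁻¹ ^ (P - 1),
    ENNReal.mul_ne_top (ENNReal.mul_ne_top hC ENNReal.ofReal_ne_top)
      (ENNReal.rpow_ne_top_of_nonneg hP1.le ENNReal.ofReal_ne_top), fun g hg => ?_⟩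
  have hF := measurable_peetreConvMax lam hg
  have hm1 : Measurable fun z : Rn n × ℝ => ENNReal.ofReal (P * z.2 ^ (P - 1)) *
      {t : ℝ | ENNReal.ofReal t < peetreConvMax lam g z.1}.indicator (1 : ℝ → ℝ≥0∞) z.2 := by
    have : (fun z : Rn n × ℝ => {t : ℝ | ENNReal.ofReal t < peetreConvMax lam g z.1}.indicator
        (1 : ℝ → ℝ≥0∞) z.2) = {z : Rn n × ℝ | ENNReal.ofReal z.2 <
          peetreConvMax lam g z.1}.indicator 1 := by
      ext z; simp [Set.indicator]
    refine Measurable.mul (by fun_prop) ?_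
    rw [this]
    exact measurable_one.indicator (measurableSet_lt (by fun_prop) (by fun_prop))
  have hm2 : Measurable fun z : ℝ × Rn n => ENNReal.ofReal ((P - 1) * z.1 ^ (P - 1 - 1)) *
      {x | ENNReal.ofReal (κ * z.1) < g x}.indicator g z.2 := by
    have : (fun z : ℝ × Rn n => {x | ENNReal.ofReal (κ * z.1) < g x}.indicator g z.2) =
        {z : ℝ × Rn n | ENNReal.ofReal (κ * z.1) < g z.2}.indicator fun z => g z.2 := by
      ext z; simp [Set.indicator]
    refine Measurable.mul (by fun_prop) ?_
    rw [this]
    exact (hg.comp measurable_snd).indicator (measurableSet_lt (by fun_prop) (by fun_prop))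
  -- Marcinkiewicz interpolation: layer cake with exponent `P`, the weak bound at each height, whose
  -- factor `1 / t` lowers the exponent, then layer cake backwards with exponent `P - 1` for `g /
  -- κ`.
  calc ∫⁻ x, peetreConvMax lam g x ^ P
      = ∫⁻ x, ∫⁻ t in Set.Ioi (0 : ℝ), ENNReal.ofReal (P * t ^ (P - 1)) *
          {t : ℝ | ENNReal.ofReal t < peetreConvMax lam g x}.indicator 1 t := by
        simp_rw [← rpow_eq_lintegral_Ioi hP0]
    _ = ∫⁻ t in Set.Ioi (0 : ℝ), ∫⁻ x, ENNReal.ofReal (P * t ^ (P - 1)) *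
          {t : ℝ | ENNReal.ofReal t < peetreConvMax lam g x}.indicator 1 t :=
        lintegral_lintegral_swap hm1.aemeasurable
    _ ≤ ∫⁻ t in Set.Ioi (0 : ℝ), C * ENNReal.ofReal (P / (P - 1)) *
          ∫⁻ x, ENNReal.ofReal ((P - 1) * t ^ (P - 1 - 1)) *
            {x | ENNReal.ofReal (κ * t) < g x}.indicator g x := by
        refine setLIntegral_mono' measurableSet_Ioi fun t (ht : 0 < t) => ?_
        have hS : MeasurableSet {x | ENNReal.ofReal t < peetreConvMax lam g x} :=
          measurableSet_lt measurable_const hF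
        have hS' : MeasurableSet {x | ENNReal.ofReal (κ * t) < g x} :=
          measurableSet_lt measurable_const hg
        have hind : ∀ x, {t : ℝ | ENNReal.ofReal t < peetreConvMax lam g x}.indicator
            (1 : ℝ → ℝ≥0∞) t = {x | ENNReal.ofReal t < peetreConvMax lam g x}.indicator 1 x := by
          intro x; simp [Set.indicator]
        simp_rw [hind]
        rw [lintegral_const_mul _ (measurable_one.indicator hS), lintegral_indicator_one hS,
          lintegral_const_mul _ (hg.indicator hS'), lintegral_indicator hS']
        refine (mul_le_mul_right (hweak g hg t ht) _).trans_eq ?_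
        rw [← mul_assoc, ← mul_assoc]
        congr 1
        rw [ENNReal.div_eq_inv_mul, ← mul_assoc, mul_comm _ C, mul_assoc C, ← ENNReal.ofReal_mul
          (by positivity), ← ENNReal.ofReal_inv_of_pos ht, ← ENNReal.ofReal_mul (by positivity)]
        congr 2
        rw [Real.rpow_sub_one ht.ne' (P - 1)]
        field_simp
    _ = C * ENNReal.ofReal (P / (P - 1)) * ∫⁻ t in Set.Ioi (0 : ℝ),
          ∫⁻ x, ENNReal.ofReal ((P - 1) * t ^ (P - 1 - 1)) *
            {x | ENNReal.ofReal (κ * t) < g x}.indicator g x :=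
        lintegral_const_mul _ hm2.lintegral_prod_right'
    _ = C * ENNReal.ofReal (P / (P - 1)) * ∫⁻ x, ∫⁻ t in Set.Ioi (0 : ℝ),
          ENNReal.ofReal ((P - 1) * t ^ (P - 1 - 1)) *
            {x | ENNReal.ofReal (κ * t) < g x}.indicator g x := by
        rw [lintegral_lintegral_swap hm2.aemeasurable]
    _ = C * ENNReal.ofReal (P / (P - 1)) * ∫⁻ x, ENNReal.ofReal κ⁻¹ ^ (P - 1) * g x ^ P := by
        congr 2; ext x
        have h1 : ∀ t : ℝ, {x | ENNReal.ofReal (κ * t) < g x}.indicator g x =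
            {t : ℝ | ENNReal.ofReal t < ENNReal.ofReal κ⁻¹ * g x}.indicator 1 t * g x := by
          intro t
          have : ENNReal.ofReal (κ * t) < g x ↔ ENNReal.ofReal t < ENNReal.ofReal κ⁻¹ * g x := by
            rw [ENNReal.ofReal_mul hκ.le, ENNReal.ofReal_inv_of_pos hκ, mul_comm (_⁻¹),
              ← div_eq_mul_inv, ENNReal.lt_div_iff_mul_lt (Or.inl (by simpa using hκ))
                (Or.inl ENNReal.ofReal_ne_top), mul_comm]
          by_cases h : ENNReal.ofReal (κ * t) < g x
          · rw [Set.indicator_of_mem (by exact h), Set.indicator_of_mem (by exact this.1 h)]; simp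
          · rw [Set.indicator_of_notMem (by exact h),
              Set.indicator_of_notMem (by exact fun h' => h (this.2 h'))]; simp
        simp_rw [h1, ← mul_assoc]
        rw [lintegral_mul_const'' _ (by
          refine (Measurable.mul (by fun_prop) (measurable_one.indicator ?_)).aemeasurable
          exact measurableSet_lt (by fun_prop) (by fun_prop)), ← rpow_eq_lintegral_Ioi hP1,
          ENNReal.mul_rpow_of_nonneg _ _ hP1.le, mul_assoc]
        congr 1
        nth_rw 2 [← ENNReal.rpow_one (g x)]
        rw [← ENNReal.rpow_add_of_nonneg _ _ hP1.le zero_le_one, sub_add_cancel]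
    _ = _ := by
        rw [lintegral_const_mul _ (by fun_prop), ← mul_assoc]

/-! ### Vector-valued inequalities by duality and weights -/

/-- Absorption of a lower power of the unknown. Finiteness of `X` is essential, which is why
truncations and qualitative bounds are arranged wherever this is applied. -/
lemma rpow_one_sub_le {X Z : ℝ≥0∞} {θ : ℝ} (hX : X ≠ ⊤) (hθ : θ < 1) (h : X ≤ Z * X ^ θ) :
    X ^ (1 - θ) ≤ Z := by
  rcases eq_or_ne X 0 with rfl | h0
  · rw [ENNReal.zero_rpow_of_pos (by linarith)]; exact zero_le
  rw [sub_eq_add_neg, ENNReal.rpow_add _ _ h0 hX, ENNReal.rpow_one]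
  calc X * X ^ (-θ) ≤ Z * X ^ θ * X ^ (-θ) := by gcongr
    _ ≤ Z * 1 := by rw [mul_assoc]; gcongr; exact rpow_mul_rpow_neg_le_one _ _
    _ = Z := mul_one Z

/-- To bound `∫ f ^ p` it is enough to bound it for the truncations of `f`. -/
lemma lintegral_rpow_le_of_truncation {f : Rn n → ℝ≥0∞} (hf : Measurable f) {p : ℝ} (hp : 0 < p)
    {B : ℝ≥0∞} (h : ∀ k : ℕ, ∫⁻ x, (Metric.closedBall (0 : Rn n) k).indicator
      (fun x => min (f x) k) x ^ p ≤ B) : ∫⁻ x, f x ^ p ≤ B := by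
  have hpt : ∀ x, f x ^ p ≤ ⨆ k : ℕ, (Metric.closedBall (0 : Rn n) k).indicator
      (fun x => min (f x) k) x ^ p := by
    intro x
    refine le_of_forall_lt fun c hc => ?_
    have hc1 : c ^ (1 / p) < f x := by
      have := ENNReal.rpow_lt_rpow hc (one_div_pos.2 hp)
      rwa [← ENNReal.rpow_mul, mul_one_div_cancel hp.ne', ENNReal.rpow_one] at this
    obtain ⟨k₁, hk₁⟩ := ENNReal.exists_nat_gt (ne_top_of_lt hc1)
    obtain ⟨k₂, hk₂⟩ := exists_nat_ge ‖x‖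
    refine lt_iSup_iff.2 ⟨max k₁ k₂, ?_⟩
    rw [Set.indicator_of_mem (by
      rw [mem_closedBall_zero_iff]; exact hk₂.trans (by exact_mod_cast le_max_right _ _))]
    have : c ^ (1 / p) < min (f x) ((max k₁ k₂ : ℕ) : ℝ≥0∞) :=
      lt_min hc1 (hk₁.trans_le (by exact_mod_cast le_max_left _ _))
    have := ENNReal.rpow_lt_rpow this hp
    rwa [← ENNReal.rpow_mul, one_div_mul_cancel hp.ne', ENNReal.rpow_one] at this
  refine (lintegral_mono hpt).trans ?_
  rw [lintegral_iSup]
  · exact iSup_le h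
  · intro k
    exact ((hf.min measurable_const).indicator measurableSet_closedBall).pow_const p
  · intro k l hkl x
    dsimp only
    refine ENNReal.rpow_le_rpow ?_ hp.le
    have hkl' : (k : ℝ) ≤ l := by exact_mod_cast hkl
    by_cases hx : x ∈ Metric.closedBall (0 : Rn n) k
    · rw [Set.indicator_of_mem hx,
        Set.indicator_of_mem (Metric.closedBall_subset_closedBall hkl' hx)]
      gcongr
    · rw [Set.indicator_of_notMem hx]; exact zero_le

/-- The dual form of the maximal inequality. -/
lemma exists_lintegral_tsum_peetreConv_rpow_le (hn : 0 < n) {lam : ℝ} (hlam : (n : ℝ) < lam)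
    {p : ℝ} (hp : 1 < p) :
    ∃ C : ℝ≥0∞, C ≠ ⊤ ∧ ∀ h : ℤ → Rn n → ℝ≥0∞, (∀ j, Measurable (h j)) →
      ∫⁻ x, (∑' j : ℤ, peetreConv ((2 : ℝ) ^ ((j : ℝ) / 2)) lam (h j) x) ^ p ≤
        C * ∫⁻ x, (∑' j : ℤ, h j x) ^ p := by
  have hpq : p.HolderConjugate (p / (p - 1)) := Real.HolderConjugate.conjExponent hp
  have hp0 : 0 < p := by linarith
  have hp1 : 0 < p - 1 := by linarith
  obtain ⟨C, hC, hmax⟩ := exists_lintegral_peetreConvMax_rpow_le hn hlam hpq.symm.lt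
  refine ⟨C ^ (p - 1), ENNReal.rpow_ne_top_of_nonneg hp1.le hC, fun h hh => ?_⟩
  set A := fun x => ∑' j : ℤ, peetreConv ((2 : ℝ) ^ ((j : ℝ) / 2)) lam (h j) x
  set S := fun x => ∑' j : ℤ, h j x
  have hA : Measurable A := Measurable.tsum fun j => measurable_peetreConv _ _ (hh j)
  have hS : Measurable S := Measurable.tsum hh
  refine lintegral_rpow_le_of_truncation hA hp0 fun k => ?_
  -- The truncation makes `∫ W ^ p` finite, so that it can be absorbed at the end.
  set W := (Metric.closedBall (0 : Rn n) k).indicator fun x => min (A x) k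
  have hW : Measurable W := (hA.min measurable_const).indicator measurableSet_closedBall
  have hWA : ∀ x, W x ≤ A x := fun x => Set.indicator_le (fun _ _ => min_le_left _ _) x
  have hfin : ∫⁻ x, W x ^ p ≠ ⊤ := by
    have : ∀ x, W x ^ p ≤ (Metric.closedBall (0 : Rn n) k).indicator
        (fun _ => (k : ℝ≥0∞) ^ p) x := by
      intro x
      by_cases hx : x ∈ Metric.closedBall (0 : Rn n) k
      · simp only [W, Set.indicator_of_mem hx]
        gcongr
        exact min_le_right _ _
      · simp only [W, Set.indicator_of_notMem hx, ENNReal.zero_rpow_of_pos hp0, le_refl]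
    refine ne_top_of_le_ne_top ?_ (lintegral_mono this)
    rw [lintegral_indicator measurableSet_closedBall, setLIntegral_const]
    exact ENNReal.mul_ne_top (ENNReal.rpow_ne_top_of_nonneg hp0.le (by simp))
      measure_closedBall_lt_top.ne
  have hexp : 1 / (p / (p - 1)) = 1 - 1 / p := by field_simp
  -- Instead of a general dual function, test against `W ^ (p - 1)`. By symmetry all convolutions
  -- move onto this one function, where they are dominated by the maximal function; Hölder and the
  -- maximal theorem with the conjugate exponent finish.
  have key : ∫⁻ x, W x ^ p ≤
      ((∫⁻ x, S x ^ p) ^ (1 / p) * C ^ (1 - 1 / p)) * (∫⁻ x, W x ^ p) ^ (1 - 1 / p) := by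
    calc ∫⁻ x, W x ^ p = ∫⁻ x, W x * W x ^ (p - 1) := by
          congr 1; ext x
          nth_rw 2 [← ENNReal.rpow_one (W x)]
          rw [← ENNReal.rpow_add_of_nonneg _ _ zero_le_one hp1.le, add_sub_cancel]
      _ ≤ ∫⁻ x, A x * W x ^ (p - 1) := by gcongr with x; exact hWA x
      _ = ∑' j : ℤ, ∫⁻ x, peetreConv ((2 : ℝ) ^ ((j : ℝ) / 2)) lam (h j) x * W x ^ (p - 1) := by
          simp only [A, ← ENNReal.tsum_mul_right]
          exact lintegral_tsum fun j =>
            ((measurable_peetreConv _ _ (hh j)).mul (hW.pow_const _)).aemeasurable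
      _ = ∑' j : ℤ, ∫⁻ x, h j x * peetreConv ((2 : ℝ) ^ ((j : ℝ) / 2)) lam
            (fun y => W y ^ (p - 1)) x := by
          congr 1; ext j
          exact lintegral_peetreConv_mul _ _ (hh j) (hW.pow_const _)
      _ ≤ ∑' j : ℤ, ∫⁻ x, h j x * peetreConvMax lam (fun y => W y ^ (p - 1)) x := by
          gcongr with j x
          exact peetreConv_le_peetreConvMax _ _ _ _
      _ = ∫⁻ x, S x * peetreConvMax lam (fun y => W y ^ (p - 1)) x := by
          simp only [S, ← ENNReal.tsum_mul_right]
          exact (lintegral_tsum fun j => ((hh j).mul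
            (measurable_peetreConvMax _ (hW.pow_const _))).aemeasurable).symm
      _ ≤ (∫⁻ x, S x ^ p) ^ (1 / p) *
            (∫⁻ x, peetreConvMax lam (fun y => W y ^ (p - 1)) x ^ (p / (p - 1))) ^
              (1 / (p / (p - 1))) :=
          ENNReal.lintegral_mul_le_Lp_mul_Lq volume hpq hS.aemeasurable
            (measurable_peetreConvMax _ (hW.pow_const _)).aemeasurable
      _ ≤ (∫⁻ x, S x ^ p) ^ (1 / p) * (C * ∫⁻ x, (W x ^ (p - 1)) ^ (p / (p - 1))) ^
              (1 / (p / (p - 1))) := by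
          have : 0 ≤ 1 / (p / (p - 1)) := by positivity
          gcongr
          exact hmax _ (hW.pow_const _)
      _ = _ := by
          simp_rw [← ENNReal.rpow_mul, mul_div_cancel₀ p hp1.ne']
          rw [hexp, ENNReal.mul_rpow_of_nonneg _ _ (by rw [← hexp]; positivity), mul_assoc]
  have h1 := rpow_one_sub_le hfin (by have : 0 < 1 / p := by positivity
                                      linarith) key
  have h2 := ENNReal.rpow_le_rpow h1 hp0.le
  rw [sub_sub_cancel, ← ENNReal.rpow_mul, one_div_mul_cancel hp0.ne', ENNReal.rpow_one,
    ENNReal.mul_rpow_of_nonneg _ _ hp0.le, ← ENNReal.rpow_mul, ← ENNReal.rpow_mul,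
    one_div_mul_cancel hp0.ne', ENNReal.rpow_one, mul_comm] at h2
  refine h2.trans_eq ?_
  congr 2
  field_simp

/-- Rubio de Francia's algorithm: every function has a majorant of comparable `L_P` norm on which
the maximal operator acts boundedly in the pointwise sense. -/
lemma exists_majorant_peetreConv_le (hn : 0 < n) {lam : ℝ} (hlam : (n : ℝ) < lam)
    {P : ℝ} (hP : 1 < P) :
    ∃ C : ℝ≥0∞, C ≠ ⊤ ∧ ∀ G : Rn n → ℝ≥0∞, Measurable G → ∃ v : Rn n → ℝ≥0∞, Measurable v ∧
      (∀ x, G x ≤ v x) ∧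
      (∀ (j : ℤ) (x : Rn n), peetreConv ((2 : ℝ) ^ ((j : ℝ) / 2)) lam v x ≤ C * v x) ∧
      ∫⁻ x, v x ^ P ≤ C * ∫⁻ x, G x ^ P := by
  obtain ⟨B, hB, hmax⟩ := exists_lintegral_peetreConvMax_rpow_le hn hlam hP
  have hP0 : 0 < P := by linarith
  -- A bound for the norm of the maximal operator on `L_P`; the `+ 1` makes it invertible.
  set D : ℝ≥0∞ := (B + 1) ^ (1 / P)
  have hDP : D ^ P = B + 1 := by
    rw [← ENNReal.rpow_mul, one_div_mul_cancel hP0.ne', ENNReal.rpow_one]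
  have hDtop : D ≠ ⊤ := ENNReal.rpow_ne_top_of_nonneg (by positivity) (by simp [hB])
  have hD0 : D ≠ 0 := by
    have : D ^ P ≠ 0 := by rw [hDP]; simp
    exact fun h => this (by rw [h, ENNReal.zero_rpow_of_pos hP0])
  have hsum : ∑' k : ℕ, (2⁻¹ : ℝ≥0∞) ^ k = 2 := by
    rw [ENNReal.tsum_geometric, ENNReal.one_sub_inv_two, inv_inv]
  refine ⟨2 * D + 2 ^ (P - 1) * 2, ?_, fun G hG => ?_⟩
  · refine ENNReal.add_ne_top.2 ⟨ENNReal.mul_ne_top (by simp) hDtop, ENNReal.mul_ne_top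
      (ENNReal.rpow_ne_top_of_nonneg (by linarith) (by simp)) (by simp)⟩
  have hit : ∀ k, Measurable ((peetreConvMax lam)^[k] G) := by
    intro k
    induction k with
    | zero => exact hG
    | succ k ih => rw [Function.iterate_succ_apply']; exact measurable_peetreConvMax _ ih
  have hitP : ∀ k, ∫⁻ x, (peetreConvMax lam)^[k] G x ^ P ≤ B ^ k * ∫⁻ x, G x ^ P := by
    intro k
    induction k with
    | zero => simp
    | succ k ih =>
      rw [Function.iterate_succ_apply']
      refine (hmax _ (hit k)).trans ?_
      rw [pow_succ', mul_assoc]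
      gcongr
  -- Applying a convolution to the series `∑ (2D)^(-k) M^k G` is dominated termwise by shifting `k`
  -- by one, at the cost of the factor `2 D`.
  set v : Rn n → ℝ≥0∞ := fun x => ∑' k : ℕ, 2⁻¹ ^ k * (D⁻¹ ^ k * (peetreConvMax lam)^[k] G x)
  have hterm : ∀ k : ℕ, Measurable fun x => D⁻¹ ^ k * (peetreConvMax lam)^[k] G x :=
    fun k => (hit k).const_mul _
  refine ⟨v, Measurable.tsum fun k => (hterm k).const_mul _, fun x => ?_, fun j x => ?_, ?_⟩
  · refine le_trans ?_ (ENNReal.le_tsum 0)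
    simp
  · calc peetreConv ((2 : ℝ) ^ ((j : ℝ) / 2)) lam v x
        = ∑' k : ℕ, 2⁻¹ ^ k * (D⁻¹ ^ k * peetreConv ((2 : ℝ) ^ ((j : ℝ) / 2)) lam
            ((peetreConvMax lam)^[k] G) x) := by
          rw [peetreConv_tsum _ _ fun k => (hterm k).const_mul _]
          congr 1; ext k
          rw [peetreConv_const_mul _ _ _ (hterm k), peetreConv_const_mul _ _ _ (hit k)]
      _ ≤ ∑' k : ℕ, 2 * D * (2⁻¹ ^ (k + 1) * (D⁻¹ ^ (k + 1) *
            (peetreConvMax lam)^[k + 1] G x)) := by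
          refine ENNReal.tsum_le_tsum fun k => ?_
          rw [Function.iterate_succ_apply']
          calc _ ≤ 2⁻¹ ^ k * (D⁻¹ ^ k * peetreConvMax lam ((peetreConvMax lam)^[k] G) x) := by
                gcongr; exact peetreConv_le_peetreConvMax _ _ _ _
            _ = (2 * 2⁻¹) * (D * D⁻¹) *
                  (2⁻¹ ^ k * (D⁻¹ ^ k * peetreConvMax lam ((peetreConvMax lam)^[k] G) x)) := by
                rw [ENNReal.mul_inv_cancel hD0 hDtop, ENNReal.mul_inv_cancel (by simp) (by simp)]
                simp
            _ = _ := by ring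
            _ ≤ _ := le_rfl
      _ ≤ 2 * D * v x := by
          rw [ENNReal.tsum_mul_left]
          gcongr
          exact ENNReal.tsum_comp_le_tsum_of_injective (add_left_injective 1)
            (fun k : ℕ => 2⁻¹ ^ k * (D⁻¹ ^ k * (peetreConvMax lam)^[k] G x))
      _ ≤ _ := by gcongr; exact le_self_add
  -- Jensen for the weights `2^(-k)`, of total mass `2`, replaces Minkowski's inequality.
  · calc ∫⁻ x, v x ^ P
        ≤ ∫⁻ x, 2 ^ (P - 1) * ∑' k : ℕ, 2⁻¹ ^ k * (D⁻¹ ^ k * (peetreConvMax lam)^[k] G x) ^ P := by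
          refine lintegral_mono fun x => ?_
          have := lintegral_mul_rpow_le (Measure.count (α := ℕ)) hP.le
            (k := fun k : ℕ => (2⁻¹ : ℝ≥0∞) ^ k)
            (g := fun k : ℕ => D⁻¹ ^ k * (peetreConvMax lam)^[k] G x)
            measurable_from_nat measurable_from_nat
          rwa [lintegral_count, lintegral_count, lintegral_count, hsum] at this
      _ = 2 ^ (P - 1) * ∑' k : ℕ, 2⁻¹ ^ k *
            ∫⁻ x, (D⁻¹ ^ k * (peetreConvMax lam)^[k] G x) ^ P := by
          rw [lintegral_const_mul _ (Measurable.tsum fun k =>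
            ((hterm k).pow_const P).const_mul _),
            lintegral_tsum fun k => (((hterm k).pow_const P).const_mul _).aemeasurable]
          congr 2; ext k
          rw [lintegral_const_mul _ ((hterm k).pow_const P)]
      _ ≤ 2 ^ (P - 1) * ∑' k : ℕ, 2⁻¹ ^ k * ∫⁻ x, G x ^ P := by
          refine mul_le_mul_right (ENNReal.tsum_le_tsum fun k => mul_le_mul_right ?_ _) _
          simp_rw [ENNReal.mul_rpow_of_nonneg _ _ hP0.le]
          rw [lintegral_const_mul _ ((hit k).pow_const P)]
          calc _ ≤ (D⁻¹ ^ k) ^ P * (B ^ k * ∫⁻ x, G x ^ P) := by gcongr; exact hitP k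
            _ = ((D ^ P)⁻¹ * B) ^ k * ∫⁻ x, G x ^ P := by
              rw [← mul_assoc, ← ENNReal.rpow_natCast (D⁻¹), ← ENNReal.rpow_mul, mul_comm (k : ℝ),
                ENNReal.rpow_mul, ENNReal.inv_rpow, ENNReal.rpow_natCast, mul_pow]
            _ ≤ 1 ^ k * ∫⁻ x, G x ^ P := by
              gcongr
              rw [hDP, ← ENNReal.div_eq_inv_mul]
              exact ENNReal.div_le_of_le_mul (by simp)
            _ = _ := by simp
      _ = 2 ^ (P - 1) * 2 * ∫⁻ x, G x ^ P := by
          rw [ENNReal.tsum_mul_right, hsum, mul_assoc]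
      _ ≤ _ := by gcongr; exact le_add_self

/-- The vector-valued maximal inequality in `L_P(ℓ^Q)` for `1 < P < Q < ∞`. -/
lemma exists_lintegral_tsum_rpow_peetreConv_le (hn : 0 < n) {lam : ℝ} (hlam : (n : ℝ) < lam)
    {P Q : ℝ} (hP : 1 < P) (hPQ : P < Q) :
    ∃ C : ℝ≥0∞, C ≠ ⊤ ∧ ∀ g : ℤ → Rn n → ℝ≥0∞, (∀ j, Measurable (g j)) →
      ∫⁻ x, (∑' j : ℤ, peetreConv ((2 : ℝ) ^ ((j : ℝ) / 2)) lam (g j) x ^ Q) ^ (P / Q) ≤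
        C * ∫⁻ x, (∑' j : ℤ, g j x ^ Q) ^ (P / Q) := by
  obtain ⟨C, hC, hmaj⟩ := exists_majorant_peetreConv_le hn hlam hP
  have hA := peetreMass_lt_top hlam
  set A := peetreMass n lam
  have hP0 : 0 < P := by linarith
  have hQ0 : 0 < Q := by linarith
  have hQ1 : 0 < Q - 1 := by linarith
  have hQP : 0 < Q - P := by linarith
  -- The exponent that results when `v ^ ((Q - P) / Q)` is raised to the conjugate exponent `Q / (Q
  -- - 1)`. It is at most `1` because `P > 1`.
  set δ := (Q - P) / (Q - 1)
  have hδ0 : 0 < δ := by positivity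
  have hδ1 : δ ≤ 1 := by rw [div_le_one hQ1]; linarith
  set K : ℝ≥0∞ := (A ^ (1 - δ) * C ^ δ) ^ (Q - 1)
  have hK : K ≠ ⊤ := ENNReal.rpow_ne_top_of_nonneg hQ1.le (ENNReal.mul_ne_top
    (ENNReal.rpow_ne_top_of_nonneg (by linarith) hA.ne)
    (ENNReal.rpow_ne_top_of_nonneg hδ0.le hC))
  refine ⟨K * A + C + 1, by simp [ENNReal.mul_eq_top, hK, hA.ne, hC], fun g hg => ?_⟩
  set G : Rn n → ℝ≥0∞ := fun x => (∑' j : ℤ, g j x ^ Q) ^ (1 / Q)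
  have hGm : Measurable G := (Measurable.tsum fun j => (hg j).pow_const Q).pow_const _
  have hGQ : ∀ x, ∑' j : ℤ, g j x ^ Q = G x ^ Q := fun x => by
    simp only [G]
    rw [← ENNReal.rpow_mul, one_div_mul_cancel hQ0.ne', ENNReal.rpow_one]
  have hgG : ∀ j x, g j x ≤ G x := fun j x => by
    rw [← ENNReal.rpow_le_rpow_iff hQ0, ← hGQ]
    exact ENNReal.le_tsum j
  have hGP : ∀ x, (∑' j : ℤ, g j x ^ Q) ^ (P / Q) = G x ^ P := fun x => by
    rw [hGQ, ← ENNReal.rpow_mul, mul_div_cancel₀ P hQ0.ne']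
  simp_rw [hGP]
  rcases eq_or_ne (∫⁻ x, G x ^ P) ⊤ with htop | hfin
  · rw [htop, ENNReal.mul_top (by simp)]; exact le_top
  -- With a majorant `v` of `G`, stable under all the convolutions, and the weight `w = v ^ (P -
  -- Q)`, the problem passes from `L_P(ℓ^Q)` to the weighted space `L_Q(w)`, where each index `j`
  -- can be treated separately.
  obtain ⟨v, hv, hGv, hTv, hvP⟩ := hmaj G hGm
  have hvfin : ∀ᵐ x, v x ≠ ⊤ := by
    have : ∀ᵐ x, v x ^ P < ⊤ := ae_lt_top (hv.pow_const P)
      (ne_top_of_le_ne_top (ENNReal.mul_ne_top hC hfin) hvP)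
    filter_upwards [this] with x hx h
    rw [h, ENNReal.top_rpow_of_pos hP0] at hx
    exact lt_irrefl _ hx
  set w : Rn n → ℝ≥0∞ := fun x => v x ^ (P - Q)
  have hw : Measurable w := hv.pow_const _
  set h : ℤ → Rn n → ℝ≥0∞ := fun j x => g j x ^ Q * w x
  have hh : ∀ j, Measurable (h j) := fun j => ((hg j).pow_const Q).mul hw
  -- Hölder for `g = (g^Q w)^(1/Q) v^((Q-P)/Q)` under the kernel. The factor with `v` is the
  -- convolution of `v ^ δ`, bounded by a multiple of `v ^ δ` through Jensen, and its power `v ^ (Q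
  -- - P)` cancels against `w`.
  have hpt : ∀ (j : ℤ) (x : Rn n), peetreConv ((2 : ℝ) ^ ((j : ℝ) / 2)) lam (g j) x ^ Q * w x ≤
      K * peetreConv ((2 : ℝ) ^ ((j : ℝ) / 2)) lam (h j) x := by
    intro j x
    set a := (2 : ℝ) ^ ((j : ℝ) / 2)
    have ha : 0 < a := two_rpow_half_pos j
    have hconj : Q.HolderConjugate (Q / (Q - 1)) := Real.HolderConjugate.conjExponent (by linarith)
    -- Where `v = 0` the factorization degenerates, but there `g j ≤ G ≤ v` vanishes as well.
    have hsplit : ∀ᵐ y, g j y ≤ h j y ^ (1 / Q) * v y ^ ((Q - P) / Q) := by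
      filter_upwards [hvfin] with y hy
      rcases eq_or_ne (v y) 0 with h0 | h0
      · have : g j y = 0 := le_zero_iff.1 (((hgG j y).trans (hGv y)).trans h0.le)
        rw [this]; exact zero_le
      · simp only [h, w]
        rw [ENNReal.mul_rpow_of_nonneg _ _ (by positivity), ← ENNReal.rpow_mul, ← ENNReal.rpow_mul,
          mul_one_div_cancel hQ0.ne', ENNReal.rpow_one, mul_assoc, ← ENNReal.rpow_add _ _ h0 hy]
        have : (P - Q) * (1 / Q) + (Q - P) / Q = 0 := by ring
        rw [this]; simp
    have hhol : peetreConv a lam (g j) x ≤ peetreConv a lam (h j) x ^ (1 / Q) *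
        peetreConv a lam (fun y => v y ^ δ) x ^ (1 / (Q / (Q - 1))) := by
      have hk : Measurable fun y => peetreKernel a lam (x - y) := by fun_prop
      have := ENNReal.lintegral_mul_le_Lp_mul_Lq
        (volume.withDensity fun y => peetreKernel a lam (x - y)) hconj
        (f := fun y => h j y ^ (1 / Q)) (g := fun y => v y ^ ((Q - P) / Q))
        ((hh j).pow_const _).aemeasurable (hv.pow_const _).aemeasurable
      rw [lintegral_withDensity_eq_lintegral_mul _ hk (((hh j).pow_const _).mul (hv.pow_const _)),
        lintegral_withDensity_eq_lintegral_mul _ hk (((hh j).pow_const _).pow_const _),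
        lintegral_withDensity_eq_lintegral_mul _ hk ((hv.pow_const _).pow_const _)] at this
      simp only [Pi.mul_apply, ← ENNReal.rpow_mul, one_div_mul_cancel hQ0.ne',
        ENNReal.rpow_one] at this
      have hδ' : (Q - P) / Q * (Q / (Q - 1)) = δ := by simp only [δ]; field_simp
      rw [hδ'] at this
      exact (peetreConv_mono a lam hsplit x).trans this
    have hTδ : peetreConv a lam (fun y => v y ^ δ) x ≤ A ^ (1 - δ) * C ^ δ * v x ^ δ := by
      refine (peetreConv_rpow_le_of_le_one ha lam hδ0 hδ1 hv x).trans ?_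
      rw [mul_assoc, ← ENNReal.mul_rpow_of_nonneg _ _ hδ0.le]
      gcongr
      exact hTv j x
    calc peetreConv a lam (g j) x ^ Q * w x
        ≤ (peetreConv a lam (h j) x ^ (1 / Q) *
            (A ^ (1 - δ) * C ^ δ * v x ^ δ) ^ (1 / (Q / (Q - 1)))) ^ Q * w x := by
          have : 0 ≤ 1 / (Q / (Q - 1)) := by positivity
          gcongr
          exact hhol.trans (by gcongr)
      _ = K * peetreConv a lam (h j) x * (v x ^ (Q - P) * v x ^ (-(Q - P))) := by
          have e1 : 1 / (Q / (Q - 1)) * Q = Q - 1 := by field_simp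
          have e2 : δ * (Q - 1) = Q - P := by simp only [δ]; field_simp
          rw [ENNReal.mul_rpow_of_nonneg _ _ hQ0.le, ← ENNReal.rpow_mul, ← ENNReal.rpow_mul, e1,
            one_div_mul_cancel hQ0.ne', ENNReal.rpow_one, ENNReal.mul_rpow_of_nonneg _ _ hQ1.le,
            ← ENNReal.rpow_mul, e2]
          simp only [w, K, neg_sub]
          ring
      _ ≤ K * peetreConv a lam (h j) x * 1 := by
          gcongr; exact rpow_mul_rpow_neg_le_one _ _
      _ = _ := mul_one _
  set E : Rn n → ℝ≥0∞ := fun x => ∑' j : ℤ, peetreConv ((2 : ℝ) ^ ((j : ℝ) / 2)) lam (g j) x ^ Q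
  -- If `E ≤ v ^ Q`, the second term suffices. Otherwise `E ^ (P/Q) = E * E ^ ((P-Q)/Q) ≤ E * v ^
  -- (P-Q)`, since the exponent is negative.
  have hsplit : ∀ x, E x ^ (P / Q) ≤ E x * w x + v x ^ P := by
    intro x
    rcases le_or_gt (E x) (v x ^ Q) with hle | hlt
    · calc E x ^ (P / Q) ≤ (v x ^ Q) ^ (P / Q) := by gcongr
        _ = v x ^ P := by rw [← ENNReal.rpow_mul, mul_div_cancel₀ P hQ0.ne']
        _ ≤ _ := le_add_self
    · refine le_trans ?_ le_self_add
      have h0 : E x ≠ 0 := (zero_le.trans_lt hlt).ne'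
      rcases eq_or_ne (E x) ⊤ with htop | hne
      · have hvt : v x ≠ ⊤ := by
          intro hvt; rw [hvt, ENNReal.top_rpow_of_pos hQ0] at hlt; exact not_top_lt hlt
        rw [htop, ENNReal.top_mul]
        · exact le_top
        · intro hw0
          rcases ENNReal.rpow_eq_zero_iff.1 hw0 with h | h
          · linarith [h.2]
          · exact hvt h.1
      · calc E x ^ (P / Q) = E x * E x ^ ((P - Q) / Q) := by
              nth_rw 2 [← ENNReal.rpow_one (E x)]
              rw [← ENNReal.rpow_add _ _ h0 hne]
              congr 1; field_simp; ring
          _ ≤ E x * (v x ^ Q) ^ ((P - Q) / Q) := by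
              gcongr 1
              have e : (P - Q) / Q = -((Q - P) / Q) := by ring
              rw [e, ENNReal.rpow_neg, ENNReal.rpow_neg]
              gcongr
          _ = E x * w x := by rw [← ENNReal.rpow_mul, mul_div_cancel₀ _ hQ0.ne']
  have hEm : Measurable fun x => E x * w x := (Measurable.tsum fun j =>
    (measurable_peetreConv _ _ (hg j)).pow_const Q).mul hw
  calc ∫⁻ x, E x ^ (P / Q) ≤ ∫⁻ x, (E x * w x + v x ^ P) := lintegral_mono hsplit
    _ = (∫⁻ x, E x * w x) + ∫⁻ x, v x ^ P := lintegral_add_left hEm _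
    _ ≤ K * A * (∫⁻ x, G x ^ P) + C * ∫⁻ x, G x ^ P := by
        refine add_le_add ?_ hvP
        calc ∫⁻ x, E x * w x
            ≤ ∫⁻ x, ∑' j : ℤ, K * peetreConv ((2 : ℝ) ^ ((j : ℝ) / 2)) lam (h j) x := by
              refine lintegral_mono fun x => ?_
              simp only [E, ← ENNReal.tsum_mul_right]
              exact ENNReal.tsum_le_tsum fun j => hpt j x
          _ = ∑' j : ℤ, K * (A * ∫⁻ x, h j x) := by
              rw [lintegral_tsum fun j =>
                ((measurable_peetreConv _ _ (hh j)).const_mul K).aemeasurable]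
              congr 1; ext j
              rw [lintegral_const_mul _ (measurable_peetreConv _ _ (hh j)),
                lintegral_peetreConv (two_rpow_half_pos j) _ (hh j)]
          _ = K * A * ∫⁻ x, ∑' j : ℤ, h j x := by
              rw [lintegral_tsum fun j => (hh j).aemeasurable, ENNReal.tsum_mul_left,
                ENNReal.tsum_mul_left, mul_assoc]
          _ ≤ K * A * ∫⁻ x, G x ^ P := by
              gcongr with x
              simp only [h]
              rw [ENNReal.tsum_mul_right, hGQ]
              -- The negative power reverses `G ≤ v`, so the weight returns the original norm of
              -- `G`.
              calc G x ^ Q * w x ≤ G x ^ Q * G x ^ (P - Q) := by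
                    gcongr 1
                    have e : P - Q = -(Q - P) := by ring
                    simp only [w, e, ENNReal.rpow_neg]
                    gcongr
                    exact hGv x
                _ ≤ G x ^ (Q + (P - Q)) := rpow_mul_rpow_le hQ0.le (by linarith) _
                _ = G x ^ P := by congr 1; ring
    _ = (K * A + C) * ∫⁻ x, G x ^ P := by ring
    _ ≤ _ := by gcongr ?_ * _; exact le_self_add

/-! ### Peetre's maximal function of a single function -/

/-- The maximal function `sup_t U(t) / (1 + a|x - t|)^s`. -/
def peetreSup (a s : ℝ) (U : Rn n → ℝ≥0∞) (x : Rn n) : ℝ≥0∞ :=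
  ⨆ t : Rn n, U t / ENNReal.ofReal ((1 + a * ‖x - t‖) ^ s)

lemma le_peetreSup_mul {a : ℝ} (ha : 0 < a) (s : ℝ) (U : Rn n → ℝ≥0∞) (x t : Rn n) :
    U t ≤ peetreSup a s U x * ENNReal.ofReal ((1 + a * ‖x - t‖) ^ s) := by
  have h0 : 0 < (1 + a * ‖x - t‖) ^ s := by positivity
  rw [← ENNReal.div_le_iff_le_mul (Or.inl (by simpa using h0)) (Or.inl ENNReal.ofReal_ne_top)]
  exact le_iSup (fun t => U t / ENNReal.ofReal ((1 + a * ‖x - t‖) ^ s)) t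

lemma le_peetreSup {a : ℝ} (ha : 0 < a) (s : ℝ) (U : Rn n → ℝ≥0∞) (x : Rn n) :
    U x ≤ peetreSup a s U x := by
  simpa using le_peetreSup_mul ha s U x x

lemma peetreSup_le {a s : ℝ} (ha : 0 < a) (hs : 0 ≤ s) {U : Rn n → ℝ≥0∞} {M : ℝ≥0∞}
    (hU : ∀ t, U t ≤ M) (x : Rn n) : peetreSup a s U x ≤ M := by
  refine iSup_le fun t => (ENNReal.div_le_of_le_mul ?_)
  refine (hU t).trans (le_mul_of_one_le_right' ?_)
  rw [ENNReal.one_le_ofReal]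
  exact Real.one_le_rpow (by have : 0 ≤ a * ‖x - t‖ := by positivity
                             linarith) hs

-- An uncountable supremum, but of functions continuous in `x`, hence lower semicontinuous.
-- Finiteness of `U t` makes each of them continuous.
@[fun_prop]
lemma measurable_peetreSup {a : ℝ} (ha : 0 < a) (s : ℝ) {U : Rn n → ℝ≥0∞} (hU : ∀ t, U t ≠ ⊤) :
    Measurable (peetreSup a s U) := by
  refine (lowerSemicontinuous_iSup fun t => Continuous.lowerSemicontinuous ?_).measurable
  simp only [div_eq_mul_inv]
  refine (ENNReal.continuous_const_mul (hU t)).comp ?_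
  refine (ENNReal.continuous_ofReal.comp ?_).inv
  refine Continuous.rpow_const (by fun_prop) fun x => Or.inl ?_
  positivity

lemma peetreKernel_mul_ofReal {a : ℝ} (ha : 0 < a) (lam b : ℝ) (x : Rn n) :
    peetreKernel a lam x * ENNReal.ofReal ((1 + a * ‖x‖) ^ b) = peetreKernel a (lam - b) x := by
  unfold peetreKernel
  rw [← ENNReal.ofReal_mul (by positivity), mul_assoc, ← Real.rpow_add (by positivity)]
  congr 3; ring

lemma peetreKernel_anti {a : ℝ} (ha : 0 < a) {lam N : ℝ} (h : lam ≤ N) (x : Rn n) :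
    peetreKernel a N x ≤ peetreKernel a lam x := by
  unfold peetreKernel
  have h1 : 1 ≤ 1 + a * ‖x‖ := by
    have : 0 ≤ a * ‖x‖ := by positivity
    linarith
  gcongr

/-- Since `1 + a|x-y| ≤ (1 + a|x-t|)(1 + a|t-y|)`, moving the centre of the kernel from `t` to `x`
costs a power of the weight `1 + a|x-t|` that occurs in Peetre's maximal function. -/
lemma peetreKernel_div_le {a : ℝ} (ha : 0 < a) {lam : ℝ} (hlam : 0 ≤ lam) {N : ℝ} (hN : lam ≤ N)
    (x t y : Rn n) :
    peetreKernel a N (t - y) ≤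
      peetreKernel a lam (x - y) * ENNReal.ofReal ((1 + a * ‖x - t‖) ^ lam) := by
  refine (peetreKernel_anti ha hN _).trans ?_
  unfold peetreKernel
  rw [← ENNReal.ofReal_mul (by positivity)]
  refine ENNReal.ofReal_le_ofReal ?_
  rw [mul_assoc]
  gcongr
  rw [Real.rpow_neg (by positivity), Real.rpow_neg (by positivity), ← div_eq_inv_mul,
    inv_eq_one_div, div_le_div_iff₀ (by positivity) (by positivity), one_mul,
    ← Real.mul_rpow (by positivity) (by positivity)]
  gcongr
  exact one_add_mul_norm_sub_le ha.le x y t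

/-- The fundamental pointwise inequality for Peetre's maximal function. -/
lemma peetreSup_rpow_le {a : ℝ} (ha : 0 < a) {s r N : ℝ} (hs : 0 < s) (hr : 0 < r) (hsN : s ≤ N)
    (hsrN : s * r ≤ N) {U : Rn n → ℝ≥0∞} (hU : Measurable U) {M : ℝ≥0∞}
    (hM : M ≠ ⊤) (hUM : ∀ t, U t ≤ M) {c : ℝ≥0∞} (h : ∀ t, U t ≤ c * peetreConv a N U t)
    (x : Rn n) :
    peetreSup a s U x ^ r ≤ (c + c ^ r * peetreMass n N ^ (r - 1)) *
      peetreConv a (s * r) (fun y => U y ^ r) x := by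
  -- For `r ≤ 1`, bound `U^(1-r)` by `X^(1-r)` times a weight that lowers the kernel exponent from
  -- `s` to `s - s(1-r) = s r`, then absorb `X^(1-r)`; the bound `M` serves only to make `X` finite.
  -- For `r > 1`, Jensen comes first and the centre is moved with exponent `s r`.
  rcases le_or_gt r 1 with hr1 | hr1
  · set X := peetreSup a s U x
    have hX : X ≠ ⊤ := ne_top_of_le_ne_top hM (peetreSup_le ha hs.le hUM x)
    have key : X ≤ c * peetreConv a (s * r) (fun y => U y ^ r) x * X ^ (1 - r) := by
      refine iSup_le fun t => ENNReal.div_le_of_le_mul ?_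
      refine (h t).trans ?_
      rw [mul_assoc, mul_assoc]
      gcongr c * ?_
      unfold peetreConv
      rw [← lintegral_mul_const _ (by fun_prop)]
      refine lintegral_mono fun y => ?_
      calc peetreKernel a N (t - y) * U y
          = peetreKernel a N (t - y) * (U y ^ r * U y ^ (1 - r)) := by
            rw [← ENNReal.rpow_add_of_nonneg _ _ hr.le (by linarith), add_sub_cancel,
              ENNReal.rpow_one]
        _ ≤ (peetreKernel a s (x - y) * ENNReal.ofReal ((1 + a * ‖x - t‖) ^ s)) *
              (U y ^ r * (X * ENNReal.ofReal ((1 + a * ‖x - y‖) ^ s)) ^ (1 - r)) := by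
            have : 0 ≤ 1 - r := by linarith
            gcongr
            · exact peetreKernel_div_le ha hs.le hsN x t y
            · exact le_peetreSup_mul ha s U x y
        _ = (peetreKernel a s (x - y) * ENNReal.ofReal ((1 + a * ‖x - y‖) ^ (s * (1 - r)))) *
              U y ^ r * (X ^ (1 - r) * ENNReal.ofReal ((1 + a * ‖x - t‖) ^ s)) := by
            rw [ENNReal.mul_rpow_of_nonneg _ _ (by linarith),
              ENNReal.ofReal_rpow_of_nonneg (by positivity) (by linarith),
              ← Real.rpow_mul (by positivity)]
            ring
        _ = _ := by
            rw [peetreKernel_mul_ofReal ha]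
            congr 3; ring
    have := rpow_one_sub_le hX (by linarith) key
    rw [sub_sub_cancel] at this
    refine this.trans ?_
    gcongr
    exact le_self_add
  · have hpt : ∀ t, U t ^ r ≤ c ^ r * peetreMass n N ^ (r - 1) *
        peetreConv a (s * r) (fun y => U y ^ r) x *
          ENNReal.ofReal ((1 + a * ‖x - t‖) ^ s) ^ r := by
      intro t
      calc U t ^ r ≤ (c * peetreConv a N U t) ^ r := by gcongr; exact h t
        _ ≤ c ^ r * (peetreMass n N ^ (r - 1) * peetreConv a N (fun y => U y ^ r) t) := by
            rw [ENNReal.mul_rpow_of_nonneg _ _ hr.le]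
            gcongr
            exact peetreConv_rpow_le ha N hr1.le hU t
        _ ≤ c ^ r * (peetreMass n N ^ (r - 1) * (peetreConv a (s * r) (fun y => U y ^ r) x *
              ENNReal.ofReal ((1 + a * ‖x - t‖) ^ (s * r)))) := by
            gcongr
            unfold peetreConv
            rw [← lintegral_mul_const _ (by fun_prop)]
            refine lintegral_mono fun y => ?_
            refine (mul_le_mul_left (peetreKernel_div_le ha (by positivity) hsrN x t y) _).trans_eq ?_
            ring
        _ = _ := by
            rw [ENNReal.ofReal_rpow_of_nonneg (by positivity) hr.le, ← Real.rpow_mul (by positivity)]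
            ring
    rw [← ENNReal.le_rpow_inv_iff hr]
    refine iSup_le fun t => ?_
    rw [ENNReal.le_rpow_inv_iff hr, ENNReal.div_rpow_of_nonneg _ _ hr.le]
    refine ENNReal.div_le_of_le_mul ((hpt t).trans ?_)
    gcongr
    exact le_add_self

/-! ### The functional calculus -/

lemma resolventI_spec (H : L2 n →ₗ.[ℂ] L2 n) :
    resolventI H = 0 ∨ ∀ g : L2 n, ∃ u : H.domain, (u : L2 n) = resolventI H g ∧
      H u + Complex.I • (u : L2 n) = g := by
  unfold resolventI
  split_ifs with h
  · exact Or.inr h.choose_spec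
  · exact Or.inl rfl

open ContinuousLinearMap in
/-- The resolvent identity `R* - R = 2i R* R` for `R = (H + i)⁻¹`. -/
lemma star_resolventI_sub {H : L2 n →ₗ.[ℂ] L2 n} (hH : IsSelfAdjoint H) :
    star (resolventI H) - resolventI H =
      (2 * Complex.I) • (star (resolventI H) * resolventI H) := by
  rcases resolventI_spec H with h0 | hR
  · simp [h0]
  set R := resolventI H
  have hform : ∀ u v : H.domain, inner ℂ (H u) (v : L2 n) = inner ℂ (u : L2 n) (H v) := by
    intro u v
    have := LinearPMap.adjoint_isFormalAdjoint hH.dense_domain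
    rw [LinearPMap.isSelfAdjoint_def.1 hH] at this
    exact this u v
  ext1 h
  refine ext_inner_left ℂ fun g => ?_
  -- With `g = (H + i)u` and `h = (H + i)v` the identity reduces to the symmetry of `H`.
  obtain ⟨u, hu, hug⟩ := hR g
  obtain ⟨v, hv, hvh⟩ := hR h
  simp only [sub_apply, inner_sub_right, _root_.smul_apply, inner_smul_right,
    mul_apply_eq_comp, star_eq_adjoint, adjoint_inner_right]
  rw [← hu, ← hv]
  nth_rw 1 [← hvh]
  nth_rw 1 [← hug]
  rw [inner_add_right, inner_add_left, inner_smul_right, inner_smul_left, hform]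
  simp only [Complex.conj_I]
  ring

/-- By the resolvent identity and normality the Cayley transform `1 - 2iR` is unitary, so `|1 - 2iz|
= 1` on the spectrum of `R`. This says `|z|² = -Im z`, that is, `z⁻¹ - i` is real. -/
lemma inv_im_of_mem_spectrum_resolventI {H : L2 n →ₗ.[ℂ] L2 n} (hH : IsSelfAdjoint H)
    (hN : IsStarNormal (resolventI H)) {z : ℂ} (hz : z ∈ spectrum ℂ (resolventI H))
    (hz0 : z ≠ 0) : (z⁻¹).im = 1 := by
  have hid := star_resolventI_sub hH
  set R := resolventI H
  have hcomm : star R * R = R * star R := hN.star_comm_self.eq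
  set W := 1 - (2 * Complex.I) • R
  have hstar : star W = 1 + (2 * Complex.I) • star R := by
    simp only [W, star_sub, star_one, star_smul]
    have : star (2 * Complex.I) = -(2 * Complex.I) := by simp
    rw [this, neg_smul, sub_neg_eq_add]
  have h1 : star W * W = 1 := by
    rw [hstar]
    simp only [W, add_mul, mul_sub, one_mul, mul_one, smul_mul_assoc, mul_smul_comm]
    refine sub_eq_zero.1 (Eq.trans (b := (2 * Complex.I) •
      ((star R - R) - (2 * Complex.I) • (star R * R))) (by module) ?_)
    rw [hid, sub_self, smul_zero]
  have h2 : W * star W = 1 := by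
    rw [← h1, hstar]
    simp only [W, add_mul, mul_add, sub_mul, mul_sub, one_mul, mul_one, smul_mul_assoc,
      mul_smul_comm, hcomm]
    module
  have hWu : W ∈ unitary (L2 n →L[ℂ] L2 n) := ⟨h1, h2⟩
  have hmem : 1 - 2 * Complex.I * z ∈ spectrum ℂ W := by
    have h3 : (2 * Complex.I) * z ∈ spectrum ℂ ((2 * Complex.I) • R) := by
      have := (spectrum.smul_mem_smul_iff (R := ℂ) (a := R) (s := z)
        (r := Units.mk0 (2 * Complex.I) (by simp))).2 hz
      simpa [Units.smul_def] using this
    have h4 := Set.sub_mem_sub (Set.mem_singleton (1 : ℂ)) h3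
    rwa [spectrum.singleton_sub_eq, map_one] at h4
  have hnorm := spectrum.subset_circle_of_unitary (𝕜 := ℂ) hWu hmem
  rw [mem_sphere_zero_iff_norm] at hnorm
  have hsq : Complex.normSq (1 - 2 * Complex.I * z) = 1 := by
    rw [Complex.normSq_eq_norm_sq, hnorm, one_pow]
  rw [Complex.normSq_apply] at hsq
  simp at hsq
  have hns : Complex.normSq z = -z.im := by
    rw [Complex.normSq_apply]; nlinarith
  have hpos : Complex.normSq z ≠ 0 := by simpa using hz0
  rw [Complex.inv_im, ← hns, div_self hpos]

/-- Only `z = 0` needs an argument. On the spectrum `z⁻¹ - i` is real and large in modulus near `0`,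
so the compact support of `φ` makes the symbol vanish there. Without restriction to the spectrum
this fails, since `Re z⁻¹` may stay bounded as `z → 0`. -/
lemma continuousOn_resolventSymbol {H : L2 n →ₗ.[ℂ] L2 n} (hH : IsSelfAdjoint H)
    (hN : IsStarNormal (resolventI H)) {φ : ℝ → ℝ} (hφ : Continuous φ)
    (hc : HasCompactSupport φ) :
    ContinuousOn (resolventSymbol φ) (spectrum ℂ (resolventI H)) := by
  intro z hz
  rcases eq_or_ne z 0 with rfl | hz0
  · obtain ⟨B, hB⟩ := hc.isCompact.isBounded.exists_norm_le
    have hev : ∀ᶠ w in 𝓝[spectrum ℂ (resolventI H)] 0, resolventSymbol φ w = 0 := by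
      have hball : ∀ᶠ w : ℂ in 𝓝 0, ‖w‖ < (|B| + 2)⁻¹ := by
        have := Metric.ball_mem_nhds (0 : ℂ) (ε := (|B| + 2)⁻¹) (by positivity)
        filter_upwards [this] with w hw using by simpa using hw
      filter_upwards [self_mem_nhdsWithin, nhdsWithin_le_nhds hball] with w hw hwb
      unfold resolventSymbol
      split_ifs with hw0
      · rfl
      have him := inv_im_of_mem_spectrum_resolventI hH hN hw hw0
      have hbig : |B| + 2 < ‖w⁻¹‖ := by
        rw [norm_inv]
        rw [lt_inv_comm₀ (by positivity) (by positivity)]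
        exact hwb
      have hre : w⁻¹ - Complex.I = ((w⁻¹ - Complex.I).re : ℂ) := by
        apply Complex.ext <;> simp [him]
      have hle : ‖w⁻¹‖ ≤ ‖w⁻¹ - Complex.I‖ + 1 := by
        calc ‖w⁻¹‖ = ‖(w⁻¹ - Complex.I) + Complex.I‖ := by rw [sub_add_cancel]
          _ ≤ _ := (norm_add_le _ _).trans (by simp)
      rw [hre, Complex.norm_real] at hle
      have : φ (w⁻¹ - Complex.I).re = 0 := by
        by_contra hne
        have := hB _ (subset_tsupport φ hne)
        have := le_abs_self B
        linarith
      rw [this]; simp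
    have h0 : resolventSymbol φ 0 = 0 := by simp [resolventSymbol]
    unfold ContinuousWithinAt
    rw [h0]
    exact tendsto_const_nhds.congr' (hev.mono fun w hw => hw.symm)
  · refine ContinuousAt.continuousWithinAt ?_
    have hev : (fun w : ℂ => ((φ (w⁻¹ - Complex.I).re : ℝ) : ℂ)) =ᶠ[𝓝 z] resolventSymbol φ := by
      filter_upwards [isOpen_ne.mem_nhds hz0] with w hw
      simp only [resolventSymbol]
      rw [if_neg hw]
    refine ContinuousAt.congr ?_ hev
    have : ContinuousAt (fun w : ℂ => (w⁻¹ - Complex.I).re) z :=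
      Complex.continuous_re.continuousAt.comp ((continuousAt_inv₀ hz0).sub continuousAt_const)
    exact Complex.continuous_ofReal.continuousAt.comp (hφ.continuousAt.comp this)

lemma spectralOp_mul {H : L2 n →ₗ.[ℂ] L2 n} (hH : IsSelfAdjoint H) {φ ψ : ℝ → ℝ}
    (hφ : Continuous φ) (hφc : HasCompactSupport φ) (hψ : Continuous ψ)
    (hψc : HasCompactSupport ψ) :
    spectralOp H (fun x => φ x * ψ x) = spectralOp H φ * spectralOp H ψ := by
  unfold spectralOp
  by_cases hN : IsStarNormal (resolventI H)
  · rw [← cfc_mul _ _ _ (continuousOn_resolventSymbol hH hN hφ hφc)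
      (continuousOn_resolventSymbol hH hN hψ hψc)]
    congr 1; ext z
    simp only [resolventSymbol]
    split_ifs <;> simp
  -- For a non-normal element `cfc` has the default value `0`, so both sides vanish.
  · simp [cfc_apply_of_not_predicate _ hN]

lemma spectralOp_sum {H : L2 n →ₗ.[ℂ] L2 n} (hH : IsSelfAdjoint H) {ι : Type*} (s : Finset ι)
    {φ : ι → ℝ → ℝ} (hφ : ∀ i, Continuous (φ i)) (hφc : ∀ i, HasCompactSupport (φ i)) :
    spectralOp H (fun x => ∑ i ∈ s, φ i x) = ∑ i ∈ s, spectralOp H (φ i) := by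
  unfold spectralOp
  by_cases hN : IsStarNormal (resolventI H)
  · rw [← cfc_sum _ _ _ fun i _ => continuousOn_resolventSymbol hH hN (hφ i) (hφc i)]
    congr 1; ext z
    simp only [resolventSymbol, Finset.sum_apply]
    split_ifs <;> simp
  · simp [cfc_apply_of_not_predicate _ hN]

/-! ### Dyadic families -/

lemma IsDyadicFamily.hasCompactSupport {φ : ℤ → ℝ → ℝ} (hφ : IsDyadicFamily φ) (j : ℤ) :
    HasCompactSupport (φ j) := by
  refine (isCompact_closedBall (0 : ℝ) ((2 : ℝ) ^ j)).of_isClosed_subset (isClosed_tsupport _)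
    fun x hx => ?_
  rw [mem_closedBall_zero_iff, Real.norm_eq_abs]
  exact (hφ.support j hx).2

/-- Closed annuli with indices two apart still touch, which is why windows of five indices occur
throughout. -/
lemma IsDyadicFamily.mem_Icc {φ ψ : ℤ → ℝ → ℝ} (hφ : IsDyadicFamily φ) (hψ : IsDyadicFamily ψ)
    {j k : ℤ} {x : ℝ} (hj : x ∈ tsupport (φ j)) (hk : ψ k x ≠ 0) :
    k ∈ Finset.Icc (j - 2) (j + 2) := by
  obtain ⟨h1, h2⟩ := hφ.support j hj
  obtain ⟨h3, h4⟩ := hψ.support k (subset_tsupport _ hk)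
  have h5 := (zpow_le_zpow_iff_right₀ (one_lt_two : (1 : ℝ) < 2)).1 (h1.trans h4)
  have h6 := (zpow_le_zpow_iff_right₀ (one_lt_two : (1 : ℝ) < 2)).1 (h3.trans h2)
  rw [Finset.mem_Icc]; constructor <;> linarith

lemma IsDyadicFamily.ne_zero {φ : ℤ → ℝ → ℝ} (hφ : IsDyadicFamily φ) {j : ℤ} {x : ℝ}
    (hj : x ∈ tsupport (φ j)) : x ≠ 0 := by
  rintro rfl
  have := (hφ.support j hj).1
  rw [abs_zero] at this
  exact absurd this (not_le.2 (by positivity))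

lemma tsum_eq_sum_Icc {φ ψ : ℤ → ℝ → ℝ} (hφ : IsDyadicFamily φ) (hψ : IsDyadicFamily ψ)
    {j : ℤ} {x : ℝ} (hj : x ∈ tsupport (φ j)) :
    ∑' k, ψ k x = ∑ k ∈ Finset.Icc (j - 2) (j + 2), ψ k x :=
  tsum_eq_sum fun k hk => by
    by_contra h
    exact hk (hφ.mem_Icc hψ hj h)

/-- The quotient of a dyadic family by the sum of a dyadic system. -/
def dyadicQuotient (φ ψ : ℤ → ℝ → ℝ) (j : ℤ) (x : ℝ) : ℝ := φ j x / ∑' k, ψ k x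

lemma dyadicQuotient_eq {φ ψ : ℤ → ℝ → ℝ} (hφ : IsDyadicFamily φ) (hψ : IsDyadicFamily ψ)
    (j : ℤ) : dyadicQuotient φ ψ j =
      fun x => φ j x / ∑ k ∈ Finset.Icc (j - 2) (j + 2), ψ k x := by
  ext x
  by_cases hx : x ∈ tsupport (φ j)
  · rw [dyadicQuotient, tsum_eq_sum_Icc hφ hψ hx]
  · simp [dyadicQuotient, image_eq_zero_of_notMem_tsupport hx]

lemma tsupport_dyadicQuotient_subset (φ ψ : ℤ → ℝ → ℝ) (j : ℤ) :
    tsupport (dyadicQuotient φ ψ j) ⊆ tsupport (φ j) :=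
  closure_mono fun x hx h => hx (by simp [dyadicQuotient, h])

lemma contDiff_sum_Icc {ψ : ℤ → ℝ → ℝ} (hψ : IsDyadicFamily ψ) (j : ℤ) :
    ContDiff ℝ ∞ fun x => ∑ k ∈ Finset.Icc (j - 2) (j + 2), ψ k x :=
  ContDiff.sum fun k _ => hψ.smooth k

lemma abs_iteratedDeriv_sum_Icc_le {ψ : ℤ → ℝ → ℝ} (hψ : IsDyadicFamily ψ) (i : ℕ) :
    ∃ c : ℝ, 0 ≤ c ∧ ∀ (j : ℤ) (x : ℝ),
      |iteratedDeriv i (fun x => ∑ k ∈ Finset.Icc (j - 2) (j + 2), ψ k x) x| ≤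
        c * (2 : ℝ) ^ (-((i : ℤ) * j)) := by
  obtain ⟨c, hc⟩ := hψ.deriv_bound i
  have hc0 : 0 ≤ c := by
    have := (abs_nonneg _).trans (hc 0 0)
    simpa using this
  -- Five terms; the shift of the index by at most `2` changes the scale factor by at most `2^(2i)`.
  refine ⟨5 * (c * 2 ^ ((i : ℤ) * 2)), by positivity, fun j x => ?_⟩
  rw [iteratedDeriv_fun_sum fun k _ => ((hψ.smooth k).of_le (by exact_mod_cast le_top)).contDiffAt]
  refine (Finset.abs_sum_le_sum_abs _ _).trans ?_
  have hterm : ∀ k ∈ Finset.Icc (j - 2) (j + 2), |iteratedDeriv i (ψ k) x| ≤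
      c * 2 ^ ((i : ℤ) * 2) * (2 : ℝ) ^ (-((i : ℤ) * j)) := by
    intro k hk
    refine (hc k x).trans ?_
    rw [mul_assoc, ← zpow_add₀ two_ne_zero]
    have := (Finset.mem_Icc.1 hk).1
    gcongr
    · norm_num
    · nlinarith
  refine (Finset.sum_le_sum hterm).trans_eq ?_
  rw [Finset.sum_const, Int.card_Icc]
  have : (j + 2 + 1 - (j - 2)).toNat = 5 := by omega
  rw [this]; simp; ring

/-- Derivatives are bounded by strong induction, without a quotient formula: Leibniz for `φ_j = Ψ
θ_j`, with `Ψ` the sum over the window, isolates `Ψ θ_j^(k)`, and `Ψ ≥ c₁` on the support of `φ_j`.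
Off that support `θ_j` vanishes locally. -/
lemma isDyadicFamily_dyadicQuotient {φ ψ : ℤ → ℝ → ℝ} (hφ : IsDyadicFamily φ)
    (hψ : IsDyadicSystem ψ) : IsDyadicFamily (dyadicQuotient φ ψ) := by
  obtain ⟨c₁, c₂, hc₁, hsum⟩ := hψ.sum_equiv
  have hlow : ∀ j x, x ∈ tsupport (φ j) → c₁ ≤ ∑ k ∈ Finset.Icc (j - 2) (j + 2), ψ k x := by
    intro j x hx
    rw [← tsum_eq_sum_Icc hφ hψ.toIsDyadicFamily hx]
    exact (hsum x (hφ.ne_zero hx)).1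
  have hsmooth : ∀ j, ContDiff ℝ ∞ (dyadicQuotient φ ψ j) := by
    intro j
    rw [contDiff_iff_contDiffAt]
    intro x
    by_cases hx : x ∈ tsupport (φ j)
    · rw [dyadicQuotient_eq hφ hψ.toIsDyadicFamily]
      exact (hφ.smooth j).contDiffAt.div (contDiff_sum_Icc hψ.toIsDyadicFamily j).contDiffAt
        (hc₁.trans_le (hlow j x hx)).ne'
    · have : dyadicQuotient φ ψ j =ᶠ[𝓝 x] 0 := notMem_tsupport_iff_eventuallyEq.1
        fun h => hx (tsupport_dyadicQuotient_subset φ ψ j h)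
      exact (contDiffAt_const (c := (0 : ℝ))).congr_of_eventuallyEq this
  refine ⟨hsmooth, fun j => (tsupport_dyadicQuotient_subset φ ψ j).trans (hφ.support j), ?_⟩
  intro k
  induction k using Nat.strong_induction_on with
  | _ k ih =>
    choose! d hd using ih
    have hd0 : ∀ i < k, 0 ≤ d i := fun i hi => by
      have := (abs_nonneg _).trans (hd i hi 0 0)
      simpa using this
    choose e he0 he using fun i => abs_iteratedDeriv_sum_Icc_le hψ.toIsDyadicFamily i
    obtain ⟨b, hb⟩ := hφ.deriv_bound k
    have hb0 : 0 ≤ b := by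
      have := (abs_nonneg _).trans (hb 0 0)
      simpa using this
    set S : ℝ := ∑ i ∈ Finset.range k, (k.choose (i + 1) : ℝ) * e (i + 1) * d (k - (i + 1))
    have hS0 : 0 ≤ S := Finset.sum_nonneg fun i hi => by
      have := Finset.mem_range.1 hi
      have := hd0 (k - (i + 1)) (by omega)
      have := he0 (i + 1)
      positivity
    refine ⟨c₁⁻¹ * (b + S), fun j x => ?_⟩
    set T : ℝ := (2 : ℝ) ^ (-((k : ℤ) * j))
    have hT : 0 < T := by positivity
    by_cases hx : x ∈ tsupport (φ j)
    swap
    · have : dyadicQuotient φ ψ j =ᶠ[𝓝 x] fun _ => 0 := notMem_tsupport_iff_eventuallyEq.1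
        fun h => hx (tsupport_dyadicQuotient_subset φ ψ j h)
      rw [this.iteratedDeriv_eq k, iteratedDeriv_const]
      simp only [ite_self, abs_zero]
      positivity
    have hprod : φ j = (fun x => ∑ k ∈ Finset.Icc (j - 2) (j + 2), ψ k x) *
        dyadicQuotient φ ψ j := by
      ext y
      rw [dyadicQuotient_eq hφ hψ.toIsDyadicFamily]
      by_cases hy : y ∈ tsupport (φ j)
      · simp only [Pi.mul_apply]
        rw [mul_div_cancel₀ _ (hc₁.trans_le (hlow j y hy)).ne']
      · simp [image_eq_zero_of_notMem_tsupport hy]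
    have hleib := iteratedDeriv_mul (n := k) (x := x)
      ((contDiff_sum_Icc hψ.toIsDyadicFamily j).of_le (by exact_mod_cast le_top)).contDiffAt
      ((hsmooth j).of_le (by exact_mod_cast le_top)).contDiffAt
    rw [← hprod, Finset.sum_range_succ'] at hleib
    simp only [Nat.choose_zero_right, Nat.cast_one, one_mul, iteratedDeriv_zero,
      Nat.sub_zero] at hleib
    have hrest : |∑ i ∈ Finset.range k, (k.choose (i + 1) : ℝ) *
        iteratedDeriv (i + 1) (fun x => ∑ k ∈ Finset.Icc (j - 2) (j + 2), ψ k x) x *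
          iteratedDeriv (k - (i + 1)) (dyadicQuotient φ ψ j) x| ≤ S * T := by
      refine (Finset.abs_sum_le_sum_abs _ _).trans ?_
      rw [Finset.sum_mul]
      refine Finset.sum_le_sum fun i hi => ?_
      have hi := Finset.mem_range.1 hi
      rw [abs_mul, abs_mul, Nat.abs_cast]
      have h1 := he (i + 1) j x
      have h2 := hd (k - (i + 1)) (by omega) j x
      have hTT : T = (2 : ℝ) ^ (-(((i + 1 : ℕ) : ℤ) * j)) *
          (2 : ℝ) ^ (-(((k - (i + 1) : ℕ) : ℤ) * j)) := by
        simp only [T]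
        rw [← zpow_add₀ two_ne_zero]
        congr 1
        rw [Nat.cast_sub (by omega)]; ring
      have h3 := he0 (i + 1)
      calc _ ≤ (k.choose (i + 1) : ℝ) * (e (i + 1) * (2 : ℝ) ^ (-(((i + 1 : ℕ) : ℤ) * j))) *
            (d (k - (i + 1)) * (2 : ℝ) ^ (-(((k - (i + 1) : ℕ) : ℤ) * j))) := by gcongr
        _ = _ := by rw [hTT]; ring
    have hmain : c₁ * |iteratedDeriv k (dyadicQuotient φ ψ j) x| ≤ (b + S) * T := by
      calc c₁ * |iteratedDeriv k (dyadicQuotient φ ψ j) x|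
          ≤ |(∑ k ∈ Finset.Icc (j - 2) (j + 2), ψ k x) *
              iteratedDeriv k (dyadicQuotient φ ψ j) x| := by
            rw [abs_mul]
            gcongr
            exact (hlow j x hx).trans (le_abs_self _)
        _ ≤ |iteratedDeriv k (φ j) x| + S * T := by
            refine le_trans ?_ (add_le_add_right hrest _)
            rw [hleib]
            have := abs_sub (∑ i ∈ Finset.range k, (k.choose (i + 1) : ℝ) *
              iteratedDeriv (i + 1) (fun x => ∑ k ∈ Finset.Icc (j - 2) (j + 2), ψ k x) x *
              iteratedDeriv (k - (i + 1)) (dyadicQuotient φ ψ j) x +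
              (∑ k ∈ Finset.Icc (j - 2) (j + 2), ψ k x) *
              iteratedDeriv k (dyadicQuotient φ ψ j) x) (∑ i ∈ Finset.range k,
              (k.choose (i + 1) : ℝ) *
              iteratedDeriv (i + 1) (fun x => ∑ k ∈ Finset.Icc (j - 2) (j + 2), ψ k x) x *
              iteratedDeriv (k - (i + 1)) (dyadicQuotient φ ψ j) x)
            rwa [add_sub_cancel_left] at this
        _ ≤ b * T + S * T := by gcongr; exact hb j x
        _ = _ := by ring
    rw [mul_assoc, ← div_eq_inv_mul, le_div_iff₀ hc₁, mul_comm]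
    exact hmain

/-- The factorization for comparing two systems: the quotient has the fixed index `j`, the
neighbours come from `ψ`. -/
lemma eq_sum_dyadicQuotient_mul {φ ψ : ℤ → ℝ → ℝ} (hφ : IsDyadicFamily φ)
    (hψ : IsDyadicSystem ψ) (j : ℤ) :
    φ j = fun x => ∑ k ∈ Finset.Icc (j - 2) (j + 2), dyadicQuotient φ ψ j x * ψ k x := by
  obtain ⟨c₁, c₂, hc₁, hsum⟩ := hψ.sum_equiv
  ext x
  rw [← Finset.mul_sum]
  by_cases hx : x ∈ tsupport (φ j)
  · rw [dyadicQuotient, ← tsum_eq_sum_Icc hφ hψ.toIsDyadicFamily hx,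
      div_mul_cancel₀ _ (hc₁.trans_le (hsum x (hφ.ne_zero hx)).1).ne']
  · simp [dyadicQuotient, image_eq_zero_of_notMem_tsupport hx]

/-- Here the neighbours sit in the quotient and `φ j` is the common factor, so that `φ_j(H)f` is
reproduced from itself alone. -/
lemma eq_sum_dyadicQuotient_self_mul {φ : ℤ → ℝ → ℝ} (hφ : IsDyadicSystem φ) (j : ℤ) :
    φ j = fun x => ∑ k ∈ Finset.Icc (j - 2) (j + 2), dyadicQuotient φ φ k x * φ j x := by
  obtain ⟨c₁, c₂, hc₁, hsum⟩ := hφ.sum_equiv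
  ext x
  rw [← Finset.sum_mul]
  by_cases hx : x ∈ tsupport (φ j)
  · simp only [dyadicQuotient]
    rw [← Finset.sum_div, ← tsum_eq_sum_Icc hφ.toIsDyadicFamily hφ.toIsDyadicFamily hx,
      div_self (hc₁.trans_le (hsum x (hφ.ne_zero hx)).1).ne', one_mul]
  · simp [image_eq_zero_of_notMem_tsupport hx]

/-! ### The functions `φ_j(H) f` -/

lemma pointwiseRep_eq {u : L2 n} {g : Rn n → ℂ} (hg : Continuous g)
    (h : (u : Rn n → ℂ) =ᵐ[volume] g) : pointwiseRep u = g := by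
  have hex : ∃ g : Rn n → ℂ, Continuous g ∧ (u : Rn n → ℂ) =ᵐ[volume] g := ⟨g, hg, h⟩
  unfold pointwiseRep
  rw [dif_pos hex]
  exact (Continuous.ae_eq_iff_eq volume hex.choose_spec.1 hg).1
    (hex.choose_spec.2.symm.trans h)

lemma peetreKernel_le_of_le_two_mul {a b : ℝ} (ha : 0 < a) (hb : 0 < b) (hab : a ≤ 2 * b)
    (hba : b ≤ 2 * a) {N : ℝ} (hN : 0 ≤ N) (x : Rn n) :
    peetreKernel a N x ≤ ENNReal.ofReal (2 ^ n * 2 ^ N) * peetreKernel b N x := by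
  unfold peetreKernel
  rw [← ENNReal.ofReal_mul (by positivity)]
  refine ENNReal.ofReal_le_ofReal ?_
  have h1 : a ^ n ≤ 2 ^ n * b ^ n := by
    rw [← mul_pow]; gcongr
  have h2 : (1 + a * ‖x‖) ^ (-N) ≤ 2 ^ N * (1 + b * ‖x‖) ^ (-N) := by
    have h3 : (2 : ℝ) ^ N = (2⁻¹ : ℝ) ^ (-N) := by
      rw [Real.inv_rpow (by norm_num), Real.rpow_neg (by norm_num), inv_inv]
    rw [h3, ← Real.mul_rpow (by norm_num) (by positivity)]
    refine Real.rpow_le_rpow_of_nonpos (by positivity) ?_ (by linarith)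
    have := mul_le_mul_of_nonneg_right hba (norm_nonneg x)
    linarith
  calc a ^ n * (1 + a * ‖x‖) ^ (-N) ≤ (2 ^ n * b ^ n) * (2 ^ N * (1 + b * ‖x‖) ^ (-N)) := by
        gcongr
    _ = _ := by ring

lemma two_rpow_half_le {j k : ℤ} (h : j ≤ k + 2) :
    (2 : ℝ) ^ ((j : ℝ) / 2) ≤ 2 * (2 : ℝ) ^ ((k : ℝ) / 2) := by
  have : (2 : ℝ) * (2 : ℝ) ^ ((k : ℝ) / 2) = (2 : ℝ) ^ (1 + (k : ℝ) / 2) := by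
    rw [Real.rpow_add two_pos, Real.rpow_one]
  rw [this]
  have h' : (j : ℝ) ≤ k + 2 := by exact_mod_cast h
  exact Real.rpow_le_rpow_of_exponent_le one_le_two (by linarith)

/-- On neighbouring dyadic scales the convolutions are comparable. -/
lemma peetreConv_le_of_mem_Icc {j k : ℤ} (hk : k ∈ Finset.Icc (j - 2) (j + 2)) {N : ℝ}
    (hN : 0 ≤ N) (g : Rn n → ℝ≥0∞) (x : Rn n) :
    peetreConv ((2 : ℝ) ^ ((k : ℝ) / 2)) N g x ≤
      ENNReal.ofReal (2 ^ n * 2 ^ N) * peetreConv ((2 : ℝ) ^ ((j : ℝ) / 2)) N g x := by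
  obtain ⟨h1, h2⟩ := Finset.mem_Icc.1 hk
  unfold peetreConv
  rw [← lintegral_const_mul' _ _ ENNReal.ofReal_ne_top]
  refine lintegral_mono fun y => ?_
  rw [← mul_assoc]
  gcongr
  exact peetreKernel_le_of_le_two_mul (two_rpow_half_pos k) (two_rpow_half_pos j)
    (two_rpow_half_le h2) (two_rpow_half_le (by linarith)) hN _

/-- For the kernel value `k ≤ a^n`: where `g ≤ k`, the product is at most `k² ≤ a^n k`; elsewhere it
is at most `g²`. This gives a finite bound, uniform in `x`, for `g` in `L₂`. -/
lemma peetreConv_le_of_sq {a : ℝ} (ha : 0 < a) {N : ℝ} (hN : 0 ≤ N) (g : Rn n → ℝ≥0∞)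
    (x : Rn n) :
    peetreConv a N g x ≤
      ENNReal.ofReal (a ^ n) * peetreMass n N + ∫⁻ y, g y ^ (2 : ℝ) := by
  have hk : ∀ y : Rn n, peetreKernel a N y ≤ ENNReal.ofReal (a ^ n) := by
    intro y
    refine ENNReal.ofReal_le_ofReal (mul_le_of_le_one_right (by positivity) ?_)
    refine Real.rpow_le_one_of_one_le_of_nonpos ?_ (by linarith)
    have : 0 ≤ a * ‖y‖ := by positivity
    linarith
  calc peetreConv a N g x
      ≤ ∫⁻ y, (ENNReal.ofReal (a ^ n) * peetreKernel a N (x - y) + g y ^ (2 : ℝ)) := by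
        refine lintegral_mono fun y => ?_
        rcases le_total (g y) (peetreKernel a N (x - y)) with h | h
        · refine le_trans ?_ le_self_add
          rw [mul_comm (ENNReal.ofReal _)]
          gcongr
          exact h.trans (hk _)
        · refine le_trans ?_ le_add_self
          rw [ENNReal.rpow_two, sq]
          gcongr
    _ = _ := by
        rw [lintegral_add_left (by fun_prop), lintegral_const_mul _ (by fun_prop),
          lintegral_peetreKernel_sub_left ha]

lemma lintegral_enorm_rpow_two_ne_top (w : L2 n) :
    ∫⁻ y, ‖(w : Rn n → ℂ) y‖ₑ ^ (2 : ℝ) ≠ ⊤ := by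
  have := (Lp.memLp w).eLpNorm_lt_top
  have h2 := lintegral_rpow_enorm_lt_top_of_eLpNorm_lt_top (p := 2) (by simp) (by simp) this
  simpa using h2.ne

lemma measurable_enorm_coeFn (w : L2 n) : Measurable fun y => ‖(w : Rn n → ℂ) y‖ₑ :=
  (Lp.stronglyMeasurable w).measurable.enorm

/-- Under the decay assumption `θ_j(H) w` is continuous and bounded by a convolution. -/
lemma exists_continuous_spectralOp {H : L2 n →ₗ.[ℂ] L2 n} (hdec : KernelDecay H)
    {θ : ℤ → ℝ → ℝ} (hθ : IsDyadicFamily θ) {N : ℕ} (hN : n < N) :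
    ∃ c : ℝ≥0∞, c ≠ ⊤ ∧ ∀ (j : ℤ) (w : L2 n), ∃ g : Rn n → ℂ, Continuous g ∧
      (spectralOp H (θ j) w : Rn n → ℂ) =ᵐ[volume] g ∧
      ∀ x, ‖g x‖ₑ ≤ c * peetreConv ((2 : ℝ) ^ ((j : ℝ) / 2)) N
        (fun y => ‖(w : Rn n → ℂ) y‖ₑ) x := by
  obtain ⟨K, hK, hdiff, hbd⟩ := hdec θ hθ
  obtain ⟨c, hc, hbd⟩ := hbd N
  refine ⟨ENNReal.ofReal c, ENNReal.ofReal_ne_top, fun j w => ?_⟩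
  set a := (2 : ℝ) ^ ((j : ℝ) / 2)
  have ha : 0 < a := two_rpow_half_pos j
  have hwm := measurable_enorm_coeFn w
  have hKb : ∀ x y, ‖K j x y‖ₑ ≤ ENNReal.ofReal c * peetreKernel a N (x - y) := by
    intro x y
    unfold peetreKernel
    rw [← ENNReal.ofReal_mul hc.le, ← ofReal_norm]
    refine ENNReal.ofReal_le_ofReal ((hbd j x y).1.trans_eq ?_)
    rw [Real.rpow_neg (by positivity), Real.rpow_natCast, ← div_eq_mul_inv]
    congr 2
    simp only [a]
    rw [← Real.rpow_natCast, ← Real.rpow_mul two_pos.le]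
    congr 1; ring
  have hmeas : ∀ x, AEStronglyMeasurable (fun y => K j x y * (w : Rn n → ℂ) y) volume := by
    intro x
    exact (((hK j).measurable.comp measurable_prodMk_left).mul
      (Lp.stronglyMeasurable w).measurable).aestronglyMeasurable
  have hconvfin : ∀ x, peetreConv a N (fun y => ‖(w : Rn n → ℂ) y‖ₑ) x ≠ ⊤ := fun x =>
    ne_top_of_le_ne_top (ENNReal.add_ne_top.2 ⟨ENNReal.mul_ne_top ENNReal.ofReal_ne_top
      (peetreMass_lt_top (by exact_mod_cast hN)).ne, lintegral_enorm_rpow_two_ne_top w⟩)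
      (peetreConv_le_of_sq ha N.cast_nonneg _ x)
  refine ⟨fun x => ∫ y, K j x y * (w : Rn n → ℂ) y, ?_, (hK j).apply_eq w, fun x => ?_⟩
  · rw [continuous_iff_continuousAt]
    intro x₀
    -- For `|x - x₀| ≤ 1` the kernel centred at `x` is at most `(1 + a)^N` times the one centred at
    -- `x₀`, which gives the majorant for dominated convergence.
    set D : ℝ≥0∞ := ENNReal.ofReal c * ENNReal.ofReal ((1 + a) ^ (N : ℝ))
    have hD : D ≠ ⊤ := ENNReal.mul_ne_top ENNReal.ofReal_ne_top ENNReal.ofReal_ne_top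
    have hbm : Measurable fun y => D * (peetreKernel a N (x₀ - y) * ‖(w : Rn n → ℂ) y‖ₑ) := by
      fun_prop
    have hfin : ∫⁻ y, D * (peetreKernel a N (x₀ - y) * ‖(w : Rn n → ℂ) y‖ₑ) ≠ ⊤ := by
      rw [lintegral_const_mul _ (by fun_prop)]
      exact ENNReal.mul_ne_top hD (hconvfin x₀)
    refine continuousAt_of_dominated (Eventually.of_forall hmeas)
      (bound := fun y => (D * (peetreKernel a N (x₀ - y) * ‖(w : Rn n → ℂ) y‖ₑ)).toReal) ?_
      (integrable_toReal_of_lintegral_ne_top hbm.aemeasurable hfin) ?_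
    · filter_upwards [Metric.ball_mem_nhds x₀ one_pos] with x hx
      refine Eventually.of_forall fun y => ?_
      rw [← toReal_enorm]
      refine ENNReal.toReal_mono (ENNReal.mul_ne_top hD (ENNReal.mul_ne_top
        ENNReal.ofReal_ne_top enorm_ne_top)) ?_
      rw [enorm_mul, ← mul_assoc]
      gcongr
      refine (hKb x y).trans ?_
      simp only [D]
      rw [mul_assoc]
      gcongr ENNReal.ofReal c * ?_
      refine (peetreKernel_div_le ha N.cast_nonneg le_rfl x₀ x y).trans ?_
      rw [mul_comm]
      gcongr
      have : ‖x₀ - x‖ ≤ 1 := by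
        rw [← dist_eq_norm, dist_comm]; exact (Metric.mem_ball.1 hx).le
      nlinarith
    · refine Eventually.of_forall fun y => ?_
      exact ((hdiff j y).continuous.continuousAt).mul continuousAt_const
  · calc ‖∫ y, K j x y * (w : Rn n → ℂ) y‖ₑ
        ≤ ∫⁻ y, ‖K j x y * (w : Rn n → ℂ) y‖ₑ := enorm_integral_le_lintegral_enorm _
      _ ≤ ∫⁻ y, ENNReal.ofReal c * (peetreKernel a N (x - y) * ‖(w : Rn n → ℂ) y‖ₑ) := by
          refine lintegral_mono fun y => ?_
          rw [enorm_mul, ← mul_assoc]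
          gcongr
          exact hKb x y
      _ = _ := lintegral_const_mul _ (by fun_prop)

/-- The bound `M` depends on `j` and `f`. Only its finiteness matters: it permits the absorption
step for Peetre's maximal function and does not enter the constants. -/
lemma specFun_spec {H : L2 n →ₗ.[ℂ] L2 n} (hdec : KernelDecay H) {φ : ℤ → ℝ → ℝ}
    (hφ : IsDyadicFamily φ) (j : ℤ) (f : 𝓢(Rn n, ℂ)) :
    Continuous (specFun H (φ j) f) ∧
      (spectralOp H (φ j) (f.toLp 2 volume) : Rn n → ℂ) =ᵐ[volume] specFun H (φ j) f ∧
      ∃ M : ℝ≥0∞, M ≠ ⊤ ∧ ∀ x, ‖specFun H (φ j) f x‖ₑ ≤ M := by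
  obtain ⟨c, hc, h⟩ := exists_continuous_spectralOp hdec hφ (Nat.lt_succ_self n)
  obtain ⟨g, hg, hae, hbd⟩ := h j (f.toLp 2 volume)
  unfold specFun
  rw [pointwiseRep_eq hg hae]
  refine ⟨hg, hae, _, ?_, fun x => (hbd x).trans (mul_le_mul_right (peetreConv_le_of_sq
    (two_rpow_half_pos j) (Nat.cast_nonneg _) _ x) _)⟩
  exact ENNReal.mul_ne_top hc (ENNReal.add_ne_top.2 ⟨ENNReal.mul_ne_top ENNReal.ofReal_ne_top
      (peetreMass_lt_top (by exact_mod_cast Nat.lt_succ_self n)).ne,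
      lintegral_enorm_rpow_two_ne_top _⟩)

/-- A factorization `φ_j = ∑ θ_{m k} ψ_{l k}` gives a pointwise bound of `φ_j(H) f` by convolutions
of the functions `ψ_{l k}(H) f`. -/
lemma enorm_specFun_le_sum {H : L2 n →ₗ.[ℂ] L2 n} (hH : IsSelfAdjoint H) (hdec : KernelDecay H)
    {φ θ ψ : ℤ → ℝ → ℝ} (hθ : IsDyadicFamily θ) (hψ : IsDyadicFamily ψ)
    {N : ℕ} (hN : n < N) :
    ∃ c : ℝ≥0∞, c ≠ ⊤ ∧ ∀ (j : ℤ) (s : Finset ℤ) (m l : ℤ → ℤ),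
      (φ j = fun x => ∑ k ∈ s, θ (m k) x * ψ (l k) x) → ∀ (f : 𝓢(Rn n, ℂ)) (x : Rn n),
        ‖specFun H (φ j) f x‖ₑ ≤ ∑ k ∈ s, c * peetreConv ((2 : ℝ) ^ ((m k : ℝ) / 2)) N
          (fun y => ‖specFun H (ψ (l k)) f y‖ₑ) x := by
  obtain ⟨c, hc, h⟩ := exists_continuous_spectralOp hdec hθ hN
  refine ⟨c, hc, fun j s m l hfac f x => ?_⟩
  choose g hg hae hbd using fun k => h (m k) (spectralOp H (ψ (l k)) (f.toLp 2 volume))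
  have hop : spectralOp H (φ j) = ∑ k ∈ s, spectralOp H (θ (m k)) * spectralOp H (ψ (l k)) := by
    have hcont : ∀ k, Continuous fun x => θ (m k) x * ψ (l k) x := fun k =>
      (hθ.smooth _).continuous.mul (hψ.smooth _).continuous
    have hcs : ∀ k, HasCompactSupport fun x => θ (m k) x * ψ (l k) x := fun k =>
      (hθ.hasCompactSupport (m k)).mul_right
    rw [hfac, spectralOp_sum hH s hcont hcs]
    refine Finset.sum_congr rfl fun k _ => ?_
    exact spectralOp_mul hH (hθ.smooth _).continuous (hθ.hasCompactSupport _)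
      (hψ.smooth _).continuous (hψ.hasCompactSupport _)
  -- The sum of the continuous representatives is continuous, so the factorization holds at every
  -- point and not merely almost everywhere.
  have heq : specFun H (φ j) f = fun x => ∑ k ∈ s, g k x := by
    refine pointwiseRep_eq (continuous_finsetSum _ fun k _ => hg k) ?_
    have e1 : spectralOp H (φ j) (f.toLp 2 volume) =
        ∑ k ∈ s, spectralOp H (θ (m k)) (spectralOp H (ψ (l k)) (f.toLp 2 volume)) := by
      rw [hop, sum_apply]; rfl
    rw [e1]
    have hall : ∀ᵐ x, ∀ k ∈ s, (spectralOp H (θ (m k)) (spectralOp H (ψ (l k))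
        (f.toLp 2 volume)) : Rn n → ℂ) x = g k x :=
      (ae_ball_iff s.countable_toSet).2 fun k _ => hae k
    filter_upwards [Lp.coeFn_finsetSum s fun k => spectralOp H (θ (m k)) (spectralOp H (ψ (l k))
      (f.toLp 2 volume)), hall] with x hx1 hx2
    rw [hx1, Finset.sum_apply]
    exact Finset.sum_congr rfl fun k hk => hx2 k hk
  rw [heq]
  refine (enorm_sum_le _ _).trans (Finset.sum_le_sum fun k _ => (hbd k x).trans ?_)
  gcongr c * ?_
  refine peetreConv_mono _ _ ?_ x
  filter_upwards [(specFun_spec hdec hψ (l k) f).2.1] with y hy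
  rw [hy]

/-- The reproducing inequality for `φ_j(H) f`. -/
lemma exists_enorm_specFun_le_peetreConv {H : L2 n →ₗ.[ℂ] L2 n} (hH : IsSelfAdjoint H)
    (hdec : KernelDecay H) {φ : ℤ → ℝ → ℝ} (hφ : IsDyadicSystem φ) {N : ℕ} (hN : n < N) :
    ∃ c : ℝ≥0∞, c ≠ ⊤ ∧ ∀ (j : ℤ) (f : 𝓢(Rn n, ℂ)) (x : Rn n),
      ‖specFun H (φ j) f x‖ₑ ≤ c * peetreConv ((2 : ℝ) ^ ((j : ℝ) / 2)) N
        (fun y => ‖specFun H (φ j) f y‖ₑ) x := by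
  have hφ' := hφ.toIsDyadicFamily
  obtain ⟨c, hc, h⟩ := enorm_specFun_le_sum (φ := φ) hH hdec (isDyadicFamily_dyadicQuotient hφ' hφ) hφ' hN
  refine ⟨5 * (c * ENNReal.ofReal (2 ^ n * 2 ^ (N : ℝ))), by
    simp [ENNReal.mul_eq_top, hc], fun j f x => ?_⟩
  refine (h j _ id (fun _ => j) (eq_sum_dyadicQuotient_self_mul hφ j) f x).trans ?_
  refine (Finset.sum_le_card_nsmul _ _ (c * (ENNReal.ofReal (2 ^ n * 2 ^ (N : ℝ)) *
    peetreConv ((2 : ℝ) ^ ((j : ℝ) / 2)) N (fun y => ‖specFun H (φ j) f y‖ₑ) x))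
    fun k hk => ?_).trans_eq ?_
  · gcongr
    exact peetreConv_le_of_mem_Icc hk N.cast_nonneg _ x
  · rw [Int.card_Icc]
    have : (j + 2 + 1 - (j - 2)).toNat = 5 := by omega
    rw [this, nsmul_eq_mul]; push_cast; ring

lemma peetreConv_le_peetreSup {a : ℝ} (ha : 0 < a) (N s : ℝ) {U : Rn n → ℝ≥0∞} (x : Rn n) :
    peetreConv a N U x ≤ peetreMass n (N - s) * peetreSup a s U x := by
  calc peetreConv a N U x
      ≤ ∫⁻ y, peetreKernel a (N - s) (x - y) * peetreSup a s U x := by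
        refine lintegral_mono fun y => ?_
        rw [← peetreKernel_mul_ofReal ha, mul_assoc, mul_comm (ENNReal.ofReal _)]
        gcongr
        exact le_peetreSup_mul ha s U x y
    _ = _ := by
        rw [lintegral_mul_const _ (by fun_prop), lintegral_peetreKernel_sub_left ha]

/-- Comparison of two dyadic systems through Peetre's maximal function. -/
lemma exists_enorm_specFun_le_sum_peetreMax {H : L2 n →ₗ.[ℂ] L2 n} (hH : IsSelfAdjoint H)
    (hdec : KernelDecay H) {φ ψ : ℤ → ℝ → ℝ} (hφ : IsDyadicFamily φ) (hψ : IsDyadicSystem ψ)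
    (s : ℝ) :
    ∃ c : ℝ≥0∞, c ≠ ⊤ ∧ ∀ (j : ℤ) (f : 𝓢(Rn n, ℂ)) (x : Rn n),
      ‖specFun H (φ j) f x‖ₑ ≤ c * ∑ k ∈ Finset.Icc (j - 2) (j + 2), peetreMax H ψ s f k x := by
  -- `N > n` is required for the kernel bound, `N - s > n` for the mass left after the Peetre weight
  -- is absorbed.
  obtain ⟨N, hN⟩ := exists_nat_gt (max (n : ℝ) (n + s))
  have hNn : n < N := by exact_mod_cast (le_max_left _ _).trans_lt hN
  obtain ⟨c, hc, h⟩ := enorm_specFun_le_sum (φ := φ) hH hdec (isDyadicFamily_dyadicQuotient hφ hψ)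
    hψ.toIsDyadicFamily hNn
  have hmass : peetreMass n ((N : ℝ) - s) ≠ ⊤ := (peetreMass_lt_top (by
    have := (le_max_right _ _).trans_lt hN
    linarith)).ne
  refine ⟨c * ENNReal.ofReal (2 ^ n * 2 ^ (N : ℝ)) * peetreMass n ((N : ℝ) - s), by
    simp [ENNReal.mul_eq_top, hc, hmass], fun j f x => ?_⟩
  refine (h j _ (fun _ => j) id (eq_sum_dyadicQuotient_mul hφ hψ j) f x).trans ?_
  rw [Finset.mul_sum]
  refine Finset.sum_le_sum fun k hk => ?_
  rw [mul_assoc, mul_assoc]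
  gcongr c * ?_
  have hk' : j ∈ Finset.Icc (k - 2) (k + 2) := by
    rw [Finset.mem_Icc] at hk ⊢; omega
  refine (peetreConv_le_of_mem_Icc hk' N.cast_nonneg _ x).trans ?_
  gcongr
  exact peetreConv_le_peetreSup (two_rpow_half_pos k) N s x

/-! ### Mixed norms -/

section Norms

variable {α : Type*} [MeasurableSpace α] {μ : Measure α}

lemma eLpNorm_le_const_mul {f g : α → ℝ≥0∞} {c : ℝ≥0∞} (hc : c ≠ ⊤) (h : ∀ x, f x ≤ c * g x)
    (p : ℝ≥0∞) : eLpNorm f p μ ≤ c * eLpNorm g p μ := by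
  lift c to ℝ≥0 using hc
  have := eLpNorm_le_nnreal_smul_eLpNorm_of_ae_le_mul' (μ := μ) (f := f) (g := g) (c := c)
    (Eventually.of_forall fun x => by simpa using h x) p
  simpa [ENNReal.smul_def] using this

lemma eLpNorm_eq_lintegral_rpow {p : ℝ≥0∞} (hp : p ≠ 0) (hp' : p ≠ ⊤) (f : α → ℝ≥0∞) :
    eLpNorm f p μ = (∫⁻ x, f x ^ p.toReal ∂μ) ^ (1 / p.toReal) := by
  rw [eLpNorm_eq_lintegral_rpow_enorm_toReal hp hp']
  simp only [enorm_eq_self]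

lemma eLpNorm_le_of_lintegral_rpow_le {p : ℝ≥0∞} (hp : p ≠ 0) (hp' : p ≠ ⊤) {f g : α → ℝ≥0∞}
    {c : ℝ≥0∞} (h : ∫⁻ x, f x ^ p.toReal ∂μ ≤ c * ∫⁻ x, g x ^ p.toReal ∂μ) :
    eLpNorm f p μ ≤ c ^ (1 / p.toReal) * eLpNorm g p μ := by
  rw [eLpNorm_eq_lintegral_rpow hp hp', eLpNorm_eq_lintegral_rpow hp hp',
    ← ENNReal.mul_rpow_of_nonneg _ _ (by positivity)]
  gcongr

/-- For `p < 1` the triangle inequality carries the factor `LpAddConst p`, which accumulates with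
the number of summands; it is applied to five. -/
lemma exists_eLpNorm_sum_le (p : ℝ≥0∞) {ι : Type*} (s : Finset ι) :
    ∃ C : ℝ≥0∞, C ≠ ⊤ ∧ ∀ f : ι → α → ℝ≥0∞, (∀ i, Measurable (f i)) →
      eLpNorm (fun x => ∑ i ∈ s, f i x) p μ ≤ C * ∑ i ∈ s, eLpNorm (f i) p μ := by
  classical
  induction s using Finset.induction_on with
  | empty => exact ⟨0, by simp, fun f _ => by simp⟩
  | insert i s hi ih =>
    obtain ⟨C, hC, h⟩ := ih
    refine ⟨ENNReal.LpAddConst p * (1 + C), ENNReal.mul_ne_top (ENNReal.LpAddConst_lt_top p).ne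
      (by simp [hC]), fun f hf => ?_⟩
    have hsum : Measurable fun x => ∑ i ∈ s, f i x := Finset.measurable_fun_sum _ fun i _ => hf i
    simp only [Finset.sum_insert hi]
    refine (eLpNorm_add_le' (hf i).aestronglyMeasurable hsum.aestronglyMeasurable p).trans ?_
    rw [mul_assoc]
    gcongr ENNReal.LpAddConst p * ?_
    rw [mul_add]
    refine add_le_add ?_ ((h f hf).trans ?_)
    · exact le_mul_of_one_le_left' le_self_add
    · gcongr; exact le_add_self

end Norms

lemma eLpNorm_count_eq_tsum {ι : Type*} [MeasurableSpace ι] [MeasurableSingletonClass ι]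
    {q : ℝ≥0∞} (hq : q ≠ 0) (hq' : q ≠ ⊤) (f : ι → ℝ≥0∞) :
    eLpNorm f q Measure.count = (∑' i, f i ^ q.toReal) ^ (1 / q.toReal) := by
  rw [eLpNorm_eq_lintegral_rpow hq hq', lintegral_count]

lemma eLpNorm_count_top {ι : Type*} [MeasurableSpace ι] [MeasurableSingletonClass ι]
    (f : ι → ℝ≥0∞) : eLpNorm f ⊤ Measure.count = ⨆ i, f i := by
  simp [eLpNorm_exponent_top]

lemma eLpNorm_count_comp_add (f : ℤ → ℝ≥0∞) (q : ℝ≥0∞) (m : ℤ) :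
    eLpNorm (fun j => f (j + m)) q Measure.count = eLpNorm f q Measure.count :=
  eLpNorm_comp_measurePreserving (g := f) Measurable.of_discrete.aestronglyMeasurable
    (measurePreserving_add_right Measure.count m)

lemma sum_Icc_sub_add {M : Type*} [AddCommMonoid M] (F : ℤ → M) (j : ℤ) :
    ∑ k ∈ Finset.Icc (j - 2) (j + 2), F k = ∑ m ∈ Finset.Icc (-2 : ℤ) 2, F (j + m) := by
  rw [show j - 2 = j + -2 by ring, ← Finset.map_add_left_Icc (-2 : ℤ) 2 j, Finset.sum_map]
  rfl

/-- The weighted `ℓ^q` norm is stable under sums over neighbouring indices. -/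
lemma exists_eLpNorm_count_le_of_le_sum (q : ℝ≥0∞) (α : ℝ) :
    ∃ C : ℝ≥0∞, C ≠ ⊤ ∧ ∀ A B : ℤ → ℝ≥0∞,
      (∀ j, A j ≤ ∑ k ∈ Finset.Icc (j - 2) (j + 2), B k) →
      eLpNorm (fun j : ℤ => ENNReal.ofReal ((2 : ℝ) ^ ((j : ℝ) * α)) * A j) q Measure.count ≤
        C * eLpNorm (fun j : ℤ => ENNReal.ofReal ((2 : ℝ) ^ ((j : ℝ) * α)) * B j) q
          Measure.count := by
  obtain ⟨C, hC, hsum⟩ := exists_eLpNorm_sum_le (μ := (Measure.count : Measure ℤ)) q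
    (Finset.Icc (-2 : ℤ) 2)
  -- Bounds the change of the weight `2^(jα)` under a shift of `j` by at most `2`.
  set D := ENNReal.ofReal ((2 : ℝ) ^ (2 * |α|))
  refine ⟨D * (C * 5), by simp [D, ENNReal.mul_eq_top, hC], fun A B h => ?_⟩
  set b : ℤ → ℝ≥0∞ := fun j => ENNReal.ofReal ((2 : ℝ) ^ ((j : ℝ) * α)) * B j
  have hpt : ∀ j : ℤ, ENNReal.ofReal ((2 : ℝ) ^ ((j : ℝ) * α)) * A j ≤
      D * ∑ m ∈ Finset.Icc (-2 : ℤ) 2, b (j + m) := by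
    intro j
    calc _ ≤ ENNReal.ofReal ((2 : ℝ) ^ ((j : ℝ) * α)) * ∑ m ∈ Finset.Icc (-2 : ℤ) 2, B (j + m) := by
          gcongr; exact (h j).trans_eq (sum_Icc_sub_add B j)
      _ ≤ _ := by
          rw [Finset.mul_sum, Finset.mul_sum]
          refine Finset.sum_le_sum fun m hm => ?_
          simp only [b, D]
          rw [← mul_assoc, ← ENNReal.ofReal_mul (by positivity), ← Real.rpow_add two_pos]
          gcongr
          · norm_num
          · obtain ⟨h1, h2⟩ := Finset.mem_Icc.1 hm
            have h1' : (-2 : ℝ) ≤ m := by exact_mod_cast h1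
            have h2' : (m : ℝ) ≤ 2 := by exact_mod_cast h2
            have h3 : |(m : ℝ) * α| ≤ 2 * |α| := by
              rw [abs_mul]; gcongr; exact abs_le.2 ⟨h1', h2'⟩
            have h4 := neg_abs_le ((m : ℝ) * α)
            push_cast
            nlinarith
  refine (eLpNorm_le_const_mul ENNReal.ofReal_ne_top hpt q).trans ?_
  rw [mul_assoc]
  gcongr D * ?_
  refine (hsum (fun m j => b (j + m)) fun _ => Measurable.of_discrete).trans_eq ?_
  simp only [eLpNorm_count_comp_add]
  simp; ring

/-- The set where the essential supremum is exceeded is open and null, hence empty. Peetre's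
supremum runs over all points, so an almost everywhere bound would not suffice for `p = ∞`. -/
lemma le_eLpNorm_top_of_continuous {g : Rn n → ℂ} (hg : Continuous g) (x : Rn n) :
    ‖g x‖ₑ ≤ eLpNorm (fun y => ‖g y‖ₑ) ⊤ volume := by
  set M := eLpNorm (fun y => ‖g y‖ₑ) ⊤ volume
  have hopen : IsOpen {y | M < ‖g y‖ₑ} := isOpen_lt continuous_const hg.enorm
  have hae : ∀ᵐ y, ‖g y‖ₑ ≤ M := by
    have := ae_le_eLpNormEssSup (f := fun y => ‖g y‖ₑ) (μ := (volume : Measure (Rn n)))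
    simpa [M, eLpNorm_exponent_top] using this
  have hnull : volume {y | M < ‖g y‖ₑ} = 0 := by
    have := ae_iff.1 hae
    simpa only [not_le] using this
  have hempty := hopen.eq_empty_of_measure_zero hnull
  exact not_lt.1 fun hx => by
    have : x ∈ {y | M < ‖g y‖ₑ} := hx
    rw [hempty] at this
    exact this

/-! ### Maximal inequalities for sequences dominated by convolutions -/

lemma lt_mul_toReal_of_div_lt {p : ℝ≥0∞} (hp : p ≠ 0) (hp' : p ≠ ⊤) {s : ℝ}
    (h : (n : ℝ≥0∞) / p < ENNReal.ofReal s) : (n : ℝ) < s * p.toReal := by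
  have hp0 : 0 < p.toReal := ENNReal.toReal_pos hp hp'
  have h1 : ENNReal.ofReal (n / p.toReal) < ENNReal.ofReal s := by
    rwa [ENNReal.ofReal_div_of_pos hp0, ENNReal.ofReal_toReal hp', ENNReal.ofReal_natCast]
  have h2 := (ENNReal.ofReal_lt_ofReal_iff_of_nonneg (by positivity)).1 h1
  exact (div_lt_iff₀ hp0).1 h2

/-- The maximal inequality in `L_p(ℓ^q)`: it holds for some auxiliary exponent `r`. -/
lemma exists_eLpNorm_eLpNorm_le (hn : 0 < n) {p q : ℝ≥0∞} {s : ℝ} (hp : 0 < p) (hp' : p < ⊤)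
    (hq : 0 < q) (hs : (n : ℝ≥0∞) / min p q < ENNReal.ofReal s) :
    ∃ r : ℝ, 0 < r ∧ ∀ C : ℝ≥0∞, C ≠ ⊤ → ∃ C' : ℝ≥0∞, C' ≠ ⊤ ∧
      ∀ b bs : ℤ → Rn n → ℝ≥0∞, (∀ j, Measurable (b j)) →
        (∀ (j : ℤ) (x : Rn n), bs j x ^ r ≤
          C * peetreConv ((2 : ℝ) ^ ((j : ℝ) / 2)) (s * r) (fun y => b j y ^ r) x) →
        eLpNorm (fun x => eLpNorm (fun j => bs j x) q Measure.count) p volume ≤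
          C' * eLpNorm (fun x => eLpNorm (fun j => b j x) q Measure.count) p volume := by
  have hp0 : 0 < p.toReal := ENNReal.toReal_pos hp.ne' hp'.ne
  have hs0 : 0 < s := ENNReal.ofReal_pos.1 (zero_le.trans_lt hs)
  suffices H : ∃ r : ℝ, 0 < r ∧ ∀ C : ℝ≥0∞, C ≠ ⊤ → ∃ C' : ℝ≥0∞, C' ≠ ⊤ ∧
      ∀ b bs : ℤ → Rn n → ℝ≥0∞, (∀ j, Measurable (b j)) →
        (∀ (j : ℤ) (x : Rn n), bs j x ^ r ≤
          C * peetreConv ((2 : ℝ) ^ ((j : ℝ) / 2)) (s * r) (fun y => b j y ^ r) x) →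
        ∫⁻ x, eLpNorm (fun j => bs j x) q Measure.count ^ p.toReal ≤
          C' * ∫⁻ x, eLpNorm (fun j => b j x) q Measure.count ^ p.toReal by
    obtain ⟨r, hr, H⟩ := H
    refine ⟨r, hr, fun C hC => ?_⟩
    obtain ⟨C', hC', H⟩ := H C hC
    exact ⟨C' ^ (1 / p.toReal), ENNReal.rpow_ne_top_of_nonneg (by positivity) hC',
      fun b bs hb hbs => eLpNorm_le_of_lintegral_rpow_le hp.ne' hp'.ne (H b bs hb hbs)⟩
  set P := p.toReal
  rcases lt_or_ge p q with hpq | hqp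
  · rw [min_eq_left hpq.le] at hs
    have hsp := lt_mul_toReal_of_div_lt hp.ne' hp'.ne hs
    -- For `p < q` there is room to choose `r` with `s r > n` and `p / r > 1` strictly, as the
    -- maximal theorem demands.
    obtain ⟨r, hr1, hr2⟩ := exists_between (show (n : ℝ) / s < P by
      rw [div_lt_iff₀ hs0, mul_comm]; exact hsp)
    have hr : 0 < r := (div_nonneg n.cast_nonneg hs0.le).trans_lt hr1
    have hsr : (n : ℝ) < s * r := by rwa [div_lt_iff₀ hs0, mul_comm] at hr1
    have hPr : 1 < P / r := (one_lt_div hr).2 hr2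
    refine ⟨r, hr, fun C hC => ?_⟩
    rcases eq_or_ne q ⊤ with rfl | hq'
    · obtain ⟨B, hB, hmax⟩ := exists_lintegral_peetreConvMax_rpow_le hn hsr hPr
      refine ⟨C ^ (P / r) * B, ENNReal.mul_ne_top (ENNReal.rpow_ne_top_of_nonneg (by positivity) hC)
        hB, fun b bs hb hbs => ?_⟩
      simp only [eLpNorm_count_top]
      set G : Rn n → ℝ≥0∞ := fun x => (⨆ j, b j x) ^ r
      have hG : Measurable G := (Measurable.iSup hb).pow_const r
      have hpt : ∀ x, (⨆ j, bs j x) ^ P ≤ C ^ (P / r) * peetreConvMax (s * r) G x ^ (P / r) := by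
        intro x
        rw [← ENNReal.mul_rpow_of_nonneg _ _ (by positivity)]
        have h1 : (⨆ j, bs j x) ^ r ≤ C * peetreConvMax (s * r) G x := by
          rw [← ENNReal.le_rpow_inv_iff hr]
          refine iSup_le fun j => ?_
          rw [ENNReal.le_rpow_inv_iff hr]
          refine (hbs j x).trans ?_
          gcongr
          refine le_trans (peetreConv_mono _ _ (Eventually.of_forall fun y => ?_) x)
            (peetreConv_le_peetreConvMax _ _ j x)
          simp only [G]
          gcongr
          exact le_iSup (fun j => b j y) j
        calc (⨆ j, bs j x) ^ P = ((⨆ j, bs j x) ^ r) ^ (P / r) := by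
              rw [← ENNReal.rpow_mul, mul_div_cancel₀ P hr.ne']
          _ ≤ _ := by gcongr
      calc _ ≤ ∫⁻ x, C ^ (P / r) * peetreConvMax (s * r) G x ^ (P / r) := lintegral_mono hpt
        _ ≤ C ^ (P / r) * (B * ∫⁻ x, G x ^ (P / r)) := by
            rw [lintegral_const_mul _ ((measurable_peetreConvMax _ hG).pow_const _)]
            gcongr
            exact hmax G hG
        _ = _ := by
            rw [mul_assoc]
            simp only [G, ← ENNReal.rpow_mul, mul_div_cancel₀ P hr.ne']
    · set Q := q.toReal
      have hQ0 : 0 < Q := ENNReal.toReal_pos hq.ne' hq'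
      have hPQ : P < Q := (ENNReal.toReal_lt_toReal hp'.ne hq').2 hpq
      obtain ⟨B, hB, hmax⟩ := exists_lintegral_tsum_rpow_peetreConv_le hn hsr hPr
        (show P / r < Q / r by gcongr)
      refine ⟨C ^ (P / r) * B, ENNReal.mul_ne_top (ENNReal.rpow_ne_top_of_nonneg (by positivity) hC)
        hB, fun b bs hb hbs => ?_⟩
      have hexp : P / r / (Q / r) = P / Q := by field_simp
      simp only [eLpNorm_count_eq_tsum hq.ne' hq', ← ENNReal.rpow_mul]
      rw [show 1 / q.toReal * P = P / Q by simp only [Q]; ring]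
      have hr' : ∀ z : ℝ≥0∞, z ^ Q = (z ^ r) ^ (Q / r) := fun z => by
        rw [← ENNReal.rpow_mul, mul_div_cancel₀ Q hr.ne']
      have hb' : ∀ j, Measurable fun y => b j y ^ r := fun j => (hb j).pow_const r
      have hpt : ∀ x, (∑' j, bs j x ^ Q) ^ (P / Q) ≤ C ^ (P / r) *
          (∑' j : ℤ, peetreConv ((2 : ℝ) ^ ((j : ℝ) / 2)) (s * r) (fun y => b j y ^ r) x ^
            (Q / r)) ^ (P / Q) := by
        intro x
        have e : C ^ (P / r) = (C ^ (Q / r)) ^ (P / Q) := by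
          rw [← ENNReal.rpow_mul]; congr 1; field_simp
        have hPQ0 : 0 ≤ P / Q := by positivity
        rw [e, ← ENNReal.mul_rpow_of_nonneg _ _ hPQ0, ← ENNReal.tsum_mul_left]
        refine ENNReal.rpow_le_rpow (ENNReal.tsum_le_tsum fun j => ?_) hPQ0
        rw [hr', ← ENNReal.mul_rpow_of_nonneg _ _ (by positivity)]
        have : 0 ≤ Q / r := by positivity
        gcongr
        exact hbs j x
      calc _ ≤ _ := lintegral_mono hpt
        _ ≤ C ^ (P / r) * (B * ∫⁻ x, (∑' j, (b j x ^ r) ^ (Q / r)) ^ (P / Q)) := by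
            rw [lintegral_const_mul _ ((Measurable.tsum fun j =>
              (measurable_peetreConv _ _ (hb' j)).pow_const _).pow_const _)]
            gcongr
            have := hmax (fun j y => b j y ^ r) hb'
            rwa [hexp] at this
        _ = _ := by
            rw [mul_assoc]
            simp only [← hr']
            rfl
  · rw [min_eq_right hqp] at hs
    have hq' : q ≠ ⊤ := ne_top_of_le_ne_top hp'.ne hqp
    have hsq := lt_mul_toReal_of_div_lt hq.ne' hq' hs
    set Q := q.toReal
    have hQ0 : 0 < Q := ENNReal.toReal_pos hq.ne' hq'
    have hPQ : Q ≤ P := (ENNReal.toReal_le_toReal hq' hp'.ne).2 hqp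
    -- For `q ≤ p` the choice `r = q` turns the inner norm into a plain sum. If `p = q` integration
    -- of the kernels suffices; if `q < p` the dual maximal inequality applies with exponent `p / q
    -- > 1`.
    obtain ⟨B, hB, hmax⟩ : ∃ B : ℝ≥0∞, B ≠ ⊤ ∧ ∀ h : ℤ → Rn n → ℝ≥0∞, (∀ j, Measurable (h j)) →
        ∫⁻ x, (∑' j : ℤ, peetreConv ((2 : ℝ) ^ ((j : ℝ) / 2)) (s * Q) (h j) x) ^ (P / Q) ≤
          B * ∫⁻ x, (∑' j, h j x) ^ (P / Q) := by
      rcases hPQ.eq_or_lt with heq | hlt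
      · refine ⟨peetreMass n (s * Q), (peetreMass_lt_top hsq).ne, fun h hh => ?_⟩
        rw [← heq, div_self hQ0.ne']
        simp only [ENNReal.rpow_one]
        rw [lintegral_tsum fun j => (measurable_peetreConv _ _ (hh j)).aemeasurable,
          lintegral_tsum fun j => (hh j).aemeasurable, ← ENNReal.tsum_mul_left]
        exact (tsum_congr fun j => lintegral_peetreConv (two_rpow_half_pos j) _ (hh j)).le
      · exact exists_lintegral_tsum_peetreConv_rpow_le hn hsq ((one_lt_div hQ0).2 hlt)
    refine ⟨Q, hQ0, fun C hC => ⟨C ^ (P / Q) * B, ENNReal.mul_ne_top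
      (ENNReal.rpow_ne_top_of_nonneg (by positivity) hC) hB, fun b bs hb hbs => ?_⟩⟩
    simp only [eLpNorm_count_eq_tsum hq.ne' hq', ← ENNReal.rpow_mul]
    rw [show 1 / q.toReal * P = P / Q by simp only [Q]; ring]
    have hb' : ∀ j, Measurable fun y => b j y ^ Q := fun j => (hb j).pow_const Q
    have hPQ0 : 0 ≤ P / Q := by positivity
    have hpt : ∀ x, (∑' j, bs j x ^ Q) ^ (P / Q) ≤ C ^ (P / Q) *
        (∑' j : ℤ, peetreConv ((2 : ℝ) ^ ((j : ℝ) / 2)) (s * Q) (fun y => b j y ^ Q) x) ^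
          (P / Q) := by
      intro x
      rw [← ENNReal.mul_rpow_of_nonneg _ _ hPQ0, ← ENNReal.tsum_mul_left]
      exact ENNReal.rpow_le_rpow (ENNReal.tsum_le_tsum fun j => hbs j x) hPQ0
    calc _ ≤ _ := lintegral_mono hpt
      _ ≤ C ^ (P / Q) * (B * ∫⁻ x, (∑' j, b j x ^ Q) ^ (P / Q)) := by
          rw [lintegral_const_mul _ ((Measurable.tsum fun j =>
            measurable_peetreConv _ _ (hb' j)).pow_const _)]
          gcongr
          exact hmax (fun j y => b j y ^ Q) hb'
      _ = _ := by rw [mul_assoc]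

/-! ### Characterization by Peetre's maximal function -/

lemma quasiNormEquiv_of_le {A B : 𝓢(Rn n, ℂ) → ℝ≥0∞} {C D : ℝ≥0∞} (hC : C ≠ ⊤) (hD : D ≠ ⊤)
    (h1 : ∀ f, A f ≤ C * B f) (h2 : ∀ f, B f ≤ D * A f) : QuasiNormEquiv A B := by
  lift C to ℝ≥0 using hC
  lift D to ℝ≥0 using hD
  refine ⟨C + D + 1, by positivity, fun f => ⟨(h1 f).trans ?_, (h2 f).trans ?_⟩⟩
  · gcongr; exact_mod_cast (le_self_add.trans le_self_add : C ≤ C + D + 1)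
  · gcongr; exact_mod_cast (le_add_self.trans le_self_add : D ≤ C + D + 1)

section

variable {H : L2 n →ₗ.[ℂ] L2 n} (hH : IsSelfAdjoint H) (hdec : KernelDecay H)
include hH hdec

lemma exists_peetreMax_rpow_le {φ : ℤ → ℝ → ℝ} (hφ : IsDyadicSystem φ) {s r : ℝ} (hs : 0 < s)
    (hr : 0 < r) :
    ∃ C : ℝ≥0∞, C ≠ ⊤ ∧ ∀ (f : 𝓢(Rn n, ℂ)) (j : ℤ) (x : Rn n),
      peetreMax H φ s f j x ^ r ≤ C * peetreConv ((2 : ℝ) ^ ((j : ℝ) / 2)) (s * r)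
        (fun y => ‖specFun H (φ j) f y‖ₑ ^ r) x := by
  obtain ⟨N, hN⟩ := exists_nat_gt (max (n : ℝ) (max s (s * r)))
  have hNn : (n : ℝ) < N := (le_max_left _ _).trans_lt hN
  have hNs : s ≤ N := ((le_max_left _ _).trans (le_max_right _ _)).trans hN.le
  have hNsr : s * r ≤ N := ((le_max_right _ _).trans (le_max_right _ _)).trans hN.le
  obtain ⟨c, hc, h⟩ := exists_enorm_specFun_le_peetreConv hH hdec hφ
    (show n < N by exact_mod_cast hNn)
  have hmass : peetreMass n (N : ℝ) ≠ ⊤ := (peetreMass_lt_top hNn).ne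
  -- For `r < 1` the mass occurs with the negative exponent `r - 1`, so it must not vanish.
  have hmass0 : peetreMass n (N : ℝ) ≠ 0 := by
    refine (lintegral_pos_iff_support (by fun_prop)).2 ?_ |>.ne'
    have : Function.support (peetreKernel (n := n) 1 N) = Set.univ := by
      ext x
      have : 0 < (1 + ‖x‖) ^ (-(N : ℝ)) := by positivity
      simpa [peetreKernel] using this
    rw [this]
    exact isOpen_univ.measure_pos volume ⟨0, trivial⟩
  refine ⟨c + c ^ r * peetreMass n N ^ (r - 1), ENNReal.add_ne_top.2 ⟨hc, ENNReal.mul_ne_top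
    (ENNReal.rpow_ne_top_of_nonneg hr.le hc) (ENNReal.rpow_ne_top_of_ne_zero hmass0 hmass)⟩,
    fun f j x => ?_⟩
  obtain ⟨hcont, -, M, hM, hbd⟩ := specFun_spec hdec hφ.toIsDyadicFamily j f
  exact peetreSup_rpow_le (two_rpow_half_pos j) hs hr hNs hNsr hcont.enorm.measurable hM hbd (h j f) x

/-- For `p < ∞` take `r = p` and integrate; the kernel of exponent `s p > n` has finite mass
independent of `j`. For `p = ∞` the maximal function is bounded by the supremum itself. -/
lemma exists_eLpNorm_peetreMax_le {φ : ℤ → ℝ → ℝ} (hφ : IsDyadicSystem φ) {p : ℝ≥0∞} {s : ℝ}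
    (hp : 0 < p) (hs : (n : ℝ≥0∞) / p < ENNReal.ofReal s) :
    ∃ C : ℝ≥0∞, C ≠ ⊤ ∧ ∀ (f : 𝓢(Rn n, ℂ)) (j : ℤ),
      eLpNorm (peetreMax H φ s f j) p volume ≤
        C * eLpNorm (fun x => ‖specFun H (φ j) f x‖ₑ) p volume := by
  have hs0 : 0 < s := ENNReal.ofReal_pos.1 (zero_le.trans_lt hs)
  rcases eq_or_ne p ⊤ with rfl | hp'
  · refine ⟨1, ENNReal.one_ne_top, fun f j => ?_⟩
    rw [one_mul]
    have hcont := (specFun_spec hdec hφ.toIsDyadicFamily j f).1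
    conv_lhs => rw [eLpNorm_exponent_top]
    refine eLpNormEssSup_le_of_ae_enorm_bound (Eventually.of_forall fun x => ?_)
    exact peetreSup_le (two_rpow_half_pos j) hs0.le (le_eLpNorm_top_of_continuous hcont) x
  · have hp0 : 0 < p.toReal := ENNReal.toReal_pos hp.ne' hp'
    have hsp := lt_mul_toReal_of_div_lt hp.ne' hp' hs
    obtain ⟨C, hC, h⟩ := exists_peetreMax_rpow_le hH hdec hφ hs0 hp0
    refine ⟨(C * peetreMass n (s * p.toReal)) ^ (1 / p.toReal),
      ENNReal.rpow_ne_top_of_nonneg (by positivity)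
        (ENNReal.mul_ne_top hC (peetreMass_lt_top hsp).ne), fun f j => ?_⟩
    have hm : Measurable fun y => ‖specFun H (φ j) f y‖ₑ ^ p.toReal :=
      (specFun_spec hdec hφ.toIsDyadicFamily j f).1.enorm.measurable.pow_const _
    refine eLpNorm_le_of_lintegral_rpow_le hp.ne' hp' ((lintegral_mono (h f j)).trans_eq ?_)
    rw [lintegral_const_mul _ (measurable_peetreConv _ _ hm),
      lintegral_peetreConv (two_rpow_half_pos j) _ hm, mul_assoc]

omit hH hdec in
lemma enorm_specFun_le_peetreMax (φ : ℤ → ℝ → ℝ) (s : ℝ) (f : 𝓢(Rn n, ℂ)) (j : ℤ) (x : Rn n) :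
    ‖specFun H (φ j) f x‖ₑ ≤ peetreMax H φ s f j x :=
  le_peetreSup (two_rpow_half_pos j) s (fun t => ‖specFun H (φ j) f t‖ₑ) x

/-- Peetre characterization of the Besov quasi-norms. -/
theorem besovNorm_equiv_peetreMax {φ : ℤ → ℝ → ℝ} (hφ : IsDyadicSystem φ) {p : ℝ≥0∞}
    (q : ℝ≥0∞) (α : ℝ) {s : ℝ} (hp : 0 < p) (hs : (n : ℝ≥0∞) / p < ENNReal.ofReal s) :
    QuasiNormEquiv (besovNorm H φ p q α) (fun f => lqLpNorm p q α (peetreMax H φ s f)) := by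
  obtain ⟨C, hC, h⟩ := exists_eLpNorm_peetreMax_le hH hdec hφ hp hs
  refine quasiNormEquiv_of_le ENNReal.one_ne_top hC (fun f => ?_) fun f => ?_
  · refine eLpNorm_le_const_mul ENNReal.one_ne_top (fun j => ?_) q
    rw [one_mul]
    gcongr
    exact eLpNorm_mono_enorm fun x => enorm_specFun_le_peetreMax φ s f j x
  · refine eLpNorm_le_const_mul hC (fun j => ?_) q
    rw [mul_left_comm]
    gcongr
    exact h f j

/-- Peetre characterization of the Triebel–Lizorkin quasi-norms. -/
theorem triebelLizorkinNorm_equiv_peetreMax (hn : 0 < n) {φ : ℤ → ℝ → ℝ}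
    (hφ : IsDyadicSystem φ) {p q : ℝ≥0∞} (α : ℝ) {s : ℝ} (hp : 0 < p) (hp' : p < ⊤) (hq : 0 < q)
    (hs : (n : ℝ≥0∞) / min p q < ENNReal.ofReal s) :
    QuasiNormEquiv (triebelLizorkinNorm H φ p q α)
      (fun f => LplqNorm p q α (peetreMax H φ s f)) := by
  have hs0 : 0 < s := ENNReal.ofReal_pos.1 (zero_le.trans_lt hs)
  obtain ⟨r, hr, hmax⟩ := exists_eLpNorm_eLpNorm_le hn hp hp' hq hs
  obtain ⟨C, hC, h⟩ := exists_peetreMax_rpow_le hH hdec hφ hs0 hr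
  obtain ⟨C', hC', hmax⟩ := hmax C hC
  refine quasiNormEquiv_of_le ENNReal.one_ne_top hC' (fun f => ?_) fun f => ?_
  · refine eLpNorm_le_const_mul ENNReal.one_ne_top (fun x => ?_) p
    rw [one_mul]
    refine eLpNorm_mono_enorm fun j => ?_
    simp only [enorm_eq_self]
    gcongr
    exact enorm_specFun_le_peetreMax φ s f j x
  · have hm : ∀ j : ℤ, Measurable fun y => ‖specFun H (φ j) f y‖ₑ := fun j =>
      (specFun_spec hdec hφ.toIsDyadicFamily j f).1.enorm.measurable
    refine hmax (fun j x => ENNReal.ofReal ((2 : ℝ) ^ ((j : ℝ) * α)) * ‖specFun H (φ j) f x‖ₑ)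
      (fun j x => ENNReal.ofReal ((2 : ℝ) ^ ((j : ℝ) * α)) * peetreMax H φ s f j x)
      (fun j => (hm j).const_mul _) fun j x => ?_
    simp only [ENNReal.mul_rpow_of_nonneg _ _ hr.le]
    rw [peetreConv_const_mul _ _ _ ((hm j).pow_const r), mul_left_comm]
    gcongr
    exact h f j x

/-! ### Independence of the dyadic system -/

/-- Any `s` above the threshold may be fixed: `φ_j(H)f` is controlled by five maximal functions of
`ψ`, a shift of index by at most two costs a constant, and the Peetre characterization for `ψ`
removes the maximal functions. -/
lemma exists_besovNorm_le {φ ψ : ℤ → ℝ → ℝ} (hφ : IsDyadicSystem φ) (hψ : IsDyadicSystem ψ)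
    {p : ℝ≥0∞} (q : ℝ≥0∞) (α : ℝ) (hp : 0 < p) :
    ∃ C : ℝ≥0∞, C ≠ ⊤ ∧ ∀ f, besovNorm H φ p q α f ≤ C * besovNorm H ψ p q α f := by
  obtain ⟨s, hs⟩ : ∃ s : ℝ, (n : ℝ≥0∞) / p < ENNReal.ofReal s := by
    obtain ⟨m, hm⟩ := ENNReal.exists_nat_gt (ENNReal.div_ne_top (ENNReal.natCast_ne_top n) hp.ne')
    exact ⟨m, by rwa [ENNReal.ofReal_natCast]⟩
  obtain ⟨C₁, -, h₁⟩ := besovNorm_equiv_peetreMax hH hdec hψ q α hp hs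
  obtain ⟨c, hc, h⟩ := exists_enorm_specFun_le_sum_peetreMax hH hdec hφ.toIsDyadicFamily hψ s
  obtain ⟨C₂, hC₂, h₂⟩ := exists_eLpNorm_count_le_of_le_sum q α
  obtain ⟨C₃, hC₃, h₃⟩ := exists_eLpNorm_sum_le (μ := (volume : Measure (Rn n))) p
    (Finset.Icc (-2 : ℤ) 2)
  have hm : ∀ (f : 𝓢(Rn n, ℂ)) (k : ℤ), Measurable (peetreMax H ψ s f k) := fun f k =>
    measurable_peetreSup (two_rpow_half_pos k) s fun t => enorm_ne_top
  refine ⟨C₂ * (c * C₃) * C₁, by simp [ENNReal.mul_eq_top, hC₂, hc, hC₃], fun f => ?_⟩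
  calc besovNorm H φ p q α f
      ≤ C₂ * eLpNorm (fun j : ℤ => ENNReal.ofReal ((2 : ℝ) ^ ((j : ℝ) * α)) *
          (c * C₃ * eLpNorm (peetreMax H ψ s f j) p volume)) q Measure.count := by
        refine h₂ _ (fun j => c * C₃ * eLpNorm (peetreMax H ψ s f j) p volume) fun j => ?_
        calc _ ≤ c * eLpNorm (fun x => ∑ m ∈ Finset.Icc (-2 : ℤ) 2,
                peetreMax H ψ s f (j + m) x) p volume :=
              eLpNorm_le_const_mul hc (fun x => (h j f x).trans_eq (by rw [sum_Icc_sub_add])) p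
          _ ≤ c * (C₃ * ∑ m ∈ Finset.Icc (-2 : ℤ) 2,
                eLpNorm (peetreMax H ψ s f (j + m)) p volume) := by
              gcongr
              exact h₃ (fun m => peetreMax H ψ s f (j + m)) fun m => hm f _
          _ = _ := by rw [← Finset.mul_sum, sum_Icc_sub_add, mul_assoc]
    _ ≤ C₂ * ((c * C₃) * lqLpNorm p q α (peetreMax H ψ s f)) := by
        gcongr
        refine eLpNorm_le_const_mul (ENNReal.mul_ne_top hc hC₃) (fun j => ?_) q
        rw [mul_left_comm]
    _ ≤ C₂ * ((c * C₃) * (C₁ * besovNorm H ψ p q α f)) := by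
        gcongr; exact (h₁ f).2
    _ = _ := by ring

lemma exists_triebelLizorkinNorm_le (hn : 0 < n) {φ ψ : ℤ → ℝ → ℝ} (hφ : IsDyadicSystem φ)
    (hψ : IsDyadicSystem ψ) {p q : ℝ≥0∞} (α : ℝ) (hp : 0 < p) (hp' : p < ⊤) (hq : 0 < q) :
    ∃ C : ℝ≥0∞, C ≠ ⊤ ∧
      ∀ f, triebelLizorkinNorm H φ p q α f ≤ C * triebelLizorkinNorm H ψ p q α f := by
  obtain ⟨s, hs⟩ : ∃ s : ℝ, (n : ℝ≥0∞) / min p q < ENNReal.ofReal s := by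
    obtain ⟨m, hm⟩ := ENNReal.exists_nat_gt (ENNReal.div_ne_top (ENNReal.natCast_ne_top n)
      (lt_min hp hq).ne')
    exact ⟨m, by rwa [ENNReal.ofReal_natCast]⟩
  obtain ⟨C₁, -, h₁⟩ := triebelLizorkinNorm_equiv_peetreMax hH hdec hn hψ α hp hp' hq hs
  obtain ⟨c, hc, h⟩ := exists_enorm_specFun_le_sum_peetreMax hH hdec hφ.toIsDyadicFamily hψ s
  obtain ⟨C₂, hC₂, h₂⟩ := exists_eLpNorm_count_le_of_le_sum q α
  refine ⟨C₂ * c * C₁, by simp [ENNReal.mul_eq_top, hC₂, hc], fun f => ?_⟩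
  calc triebelLizorkinNorm H φ p q α f
      ≤ C₂ * c * LplqNorm p q α (peetreMax H ψ s f) := by
        refine eLpNorm_le_const_mul (ENNReal.mul_ne_top hC₂ hc) (fun x => ?_) p
        refine (h₂ _ (fun j => c * peetreMax H ψ s f j x) fun j => ?_).trans ?_
        · rw [← Finset.mul_sum]; exact h j f x
        · rw [mul_assoc]
          gcongr
          refine eLpNorm_le_const_mul hc (fun j => ?_) q
          rw [mul_left_comm]
    _ ≤ C₂ * c * (C₁ * triebelLizorkinNorm H ψ p q α f) := by
        gcongr; exact (h₁ f).2
    _ = _ := by ring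

end

/-! ### Completions -/

lemma QuasiNormEquiv.symm {A B : 𝓢(Rn n, ℂ) → ℝ≥0∞} (h : QuasiNormEquiv A B) :
    QuasiNormEquiv B A := by
  obtain ⟨C, hC, h⟩ := h
  exact ⟨C, hC, fun f => (h f).symm⟩

lemma QuasiNormEquiv.isCauchyFor {A B : 𝓢(Rn n, ℂ) → ℝ≥0∞} (h : QuasiNormEquiv A B)
    {u : ℕ → 𝓢(Rn n, ℂ)} (hu : IsCauchyFor A u) : IsCauchyFor B u := by
  obtain ⟨C, hC, h⟩ := h
  have hC0 : (C : ℝ≥0∞) ≠ 0 := by exact_mod_cast hC.ne'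
  refine ⟨fun k => (h (u k)).2.trans_lt (ENNReal.mul_lt_top ENNReal.coe_lt_top (hu.1 k)),
    fun ε hε => ?_⟩
  obtain ⟨k₀, hk₀⟩ := hu.2 (ε / C) (ENNReal.div_pos hε.ne' ENNReal.coe_ne_top)
  refine ⟨k₀, fun k hk l hl => (h _).2.trans_lt ?_⟩
  rw [mul_comm]
  exact (ENNReal.lt_div_iff_mul_lt (Or.inl hC0) (Or.inl ENNReal.coe_ne_top)).1 (hk₀ k hk l hl)

lemma QuasiNormEquiv.tendsto {A B : 𝓢(Rn n, ℂ) → ℝ≥0∞} (h : QuasiNormEquiv A B)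
    {w : ℕ → 𝓢(Rn n, ℂ)} (hw : Tendsto (fun k => A (w k)) atTop (𝓝 0)) :
    Tendsto (fun k => B (w k)) atTop (𝓝 0) := by
  obtain ⟨C, hC, h⟩ := h
  have : Tendsto (fun k => (C : ℝ≥0∞) * A (w k)) atTop (𝓝 (C * 0)) :=
    ENNReal.Tendsto.const_mul hw (Or.inr ENNReal.coe_ne_top)
  rw [mul_zero] at this
  exact tendsto_of_tendsto_of_tendsto_of_le_of_le tendsto_const_nhds this
    (fun _ => zero_le) fun k => (h (w k)).2

lemma QuasiNormEquiv.sameCompletion {A B : 𝓢(Rn n, ℂ) → ℝ≥0∞} (h : QuasiNormEquiv A B) :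
    SameCompletion A B :=
  ⟨fun _ => ⟨h.isCauchyFor, h.symm.isCauchyFor⟩, fun _ _ _ _ => ⟨h.tendsto, h.symm.tendsto⟩⟩

end SchrodingerLP

end

/-! ### The main theorem -/

open SchrodingerLP in
theorem theorem1 {n : ℕ} (hn : 0 < n) (V : Rn n → ℝ) (H : L2 n →ₗ.[ℂ] L2 n)
    (hH : IsSchrodingerOperator V H) (hdec : KernelDecay H) :
    (∀ φ : ℤ → ℝ → ℝ, IsDyadicSystem φ →
      (∀ (p q : ℝ≥0∞) (α s : ℝ), 0 < p → 0 < q → (n : ℝ≥0∞) / p < ENNReal.ofReal s →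
        QuasiNormEquiv (besovNorm H φ p q α)
          (fun f => lqLpNorm p q α (peetreMax H φ s f))) ∧
      (∀ (p q : ℝ≥0∞) (α s : ℝ), 0 < p → p < ⊤ → 0 < q →
        (n : ℝ≥0∞) / min p q < ENNReal.ofReal s →
        QuasiNormEquiv (triebelLizorkinNorm H φ p q α)
          (fun f => LplqNorm p q α (peetreMax H φ s f)))) ∧
    (∀ φ ψ : ℤ → ℝ → ℝ, IsDyadicSystem φ → IsDyadicSystem ψ →
      (∀ (p q : ℝ≥0∞) (α : ℝ), 0 < p → 0 < q →
        QuasiNormEquiv (besovNorm H φ p q α) (besovNorm H ψ p q α) ∧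
        SameCompletion (besovNorm H φ p q α) (besovNorm H ψ p q α)) ∧
      (∀ (p q : ℝ≥0∞) (α : ℝ), 0 < p → p < ⊤ → 0 < q →
        QuasiNormEquiv (triebelLizorkinNorm H φ p q α) (triebelLizorkinNorm H ψ p q α) ∧
        SameCompletion (triebelLizorkinNorm H φ p q α) (triebelLizorkinNorm H ψ p q α))) := by
  have hsa := hH.selfAdjoint
  refine ⟨fun φ hφ => ⟨fun p q α s hp _ hs => besovNorm_equiv_peetreMax hsa hdec hφ q α hp hs,
    fun p q α s hp hp' hq hs =>
      triebelLizorkinNorm_equiv_peetreMax hsa hdec hn hφ α hp hp' hq hs⟩, fun φ ψ hφ hψ => ?_⟩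
  have hB : ∀ (p q : ℝ≥0∞) (α : ℝ), 0 < p →
      QuasiNormEquiv (besovNorm H φ p q α) (besovNorm H ψ p q α) := by
    intro p q α hp
    obtain ⟨C, hC, h₁⟩ := exists_besovNorm_le hsa hdec hφ hψ q α hp
    obtain ⟨D, hD, h₂⟩ := exists_besovNorm_le hsa hdec hψ hφ q α hp
    exact quasiNormEquiv_of_le hC hD h₁ h₂
  have hF : ∀ (p q : ℝ≥0∞) (α : ℝ), 0 < p → p < ⊤ → 0 < q →
      QuasiNormEquiv (triebelLizorkinNorm H φ p q α) (triebelLizorkinNorm H ψ p q α) := by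
    intro p q α hp hp' hq
    obtain ⟨C, hC, h₁⟩ := exists_triebelLizorkinNorm_le hsa hdec hn hφ hψ α hp hp' hq
    obtain ⟨D, hD, h₂⟩ := exists_triebelLizorkinNorm_le hsa hdec hn hψ hφ α hp hp' hq
    exact quasiNormEquiv_of_le hC hD h₁ h₂
  exact ⟨fun p q α hp _ => ⟨hB p q α hp, (hB p q α hp).sameCompletion⟩,
    fun p q α hp hp' hq => ⟨hF p q α hp hp' hq, (hF p q α hp hp' hq).sameCompletion⟩⟩
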